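/- There exist a $C^\infty$ diffeomorphism $f:\mathbb R^2\to\mathbb R^2$ preserving the symplectic form $dx\wedge dy$, a (non-split) separatrix $\Sigma$ of $f$, and a set $W$ such that $W$ is open in $\Sigma\cup\Delta_\Sigma$ (for the relative topology), $\Sigma\subset W$, and $W\setminus\Sigma$ contains no $f$-invariant circle. Moreover $f$ and $\Sigma$ can be chosen such that: (a) there are a smooth function $H:\mathbb R^2\to\mathbb R$, equal to $xy$ on an open neighbourhood $V$ of $o$, whose Hamiltonian vector field $J\nabla H=(-\partial_yH,\partial_xH)$ is complete and has a time-$1$ map $f_0$ that also admits $\Sigma$ as a separatrix, and a compact set $K\subset V\setminus\{o\}$, such that $f=f_0$ on $\mathbb R^2\setminus K$; (b) there are a point $z\in\Delta_\Sigma$ and integers $p_n\to+\infty$ with $\mathrm{dist}(f^{p_n}(z),\Sigma)\to 0$. Here $o=(0,0)$. A separatrix of a diffeomorphism $g$ is a compact connected set $\Sigma\ni o$ with $g(\Sigma)=\Sigma$, where $o$ is a hyperbolic fixed point of $g$ ($g(o)=o$ and $Dg(o)$ has two distinct real eigenvalues), $\Sigma\setminus\{o\}$ is a nonempty connected smooth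 one-dimensional submanifold of $\mathbb R^2$, and $\lim_{n\to\pm\infty}g^n(p)=o$ for all $p\in\Sigma$. $\Delta_\Sigma$ is the bounded connected component of $\mathbb R^2\setminus\Sigma$. A circle is the image $C$ of a continuous injective map of the unit circle into $\mathbb R^2$; it is $f$-invariant if $f(C)=C$. -/

import Mathlib

open Filter Topology Set
open scoped ContDiff

/-- The standard symplectic form `dx ∧ dy` on the plane. -/
def omega (u v : ℝ × ℝ) : ℝ := u.1 * v.2 - u.2 * v.1

/-- `f` is a `C^∞` diffeomorphism of the plane that preserves `dx ∧ dy`. -/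
structure IsSymplecticDiffeo (f : Equiv.Perm (ℝ × ℝ)) : Prop where
  contDiff : ContDiff ℝ ∞ (fun p => f p)
  contDiff_symm : ContDiff ℝ ∞ (fun p => f.symm p)
  symplectic : ∀ p u v : ℝ × ℝ,
    omega (fderiv ℝ (fun q => f q) p u) (fderiv ℝ (fun q => f q) p v) = omega u v

/-- The origin is a hyperbolic fixed point of `f`: it is fixed, `f` is differentiable there, and
the derivative has two distinct real eigenvalues.  (For an area preserving map this is
hyperbolicity, since the product of the two eigenvalues is `1`.) -/
structure IsHyperbolicFixedPt (f : Equiv.Perm (ℝ × ℝ)) : Prop where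
  fixed : f 0 = 0
  differentiableAt : DifferentiableAt ℝ (fun p => f p) 0
  eigenvalues : ∃ a b : ℝ, a ≠ b ∧
    Module.End.HasEigenvalue (fderiv ℝ (fun p => f p) 0 : ℝ × ℝ →ₗ[ℝ] ℝ × ℝ) a ∧
    Module.End.HasEigenvalue (fderiv ℝ (fun p => f p) 0 : ℝ × ℝ →ₗ[ℝ] ℝ × ℝ) b

/-- `M` is an (embedded) smooth one-dimensional submanifold of the plane: near each of its points
it is the zero set of a smooth function without critical points. -/
def IsSmoothCurve (M : Set (ℝ × ℝ)) : Prop :=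
  ∀ p ∈ M, ∃ (U : Set (ℝ × ℝ)) (g : ℝ × ℝ → ℝ), IsOpen U ∧ p ∈ U ∧ ContDiffOn ℝ ∞ g U ∧
    (∀ q ∈ U, fderiv ℝ g q ≠ 0) ∧ M ∩ U = {q ∈ U | g q = 0}

/-- `S` is a (non-split) separatrix of `f` associated with the hyperbolic fixed point `0`. -/
structure IsSeparatrix (f : Equiv.Perm (ℝ × ℝ)) (S : Set (ℝ × ℝ)) : Prop where
  hyperbolic : IsHyperbolicFixedPt f
  isCompact : IsCompact S
  isConnected : IsConnected S
  zero_mem : (0 : ℝ × ℝ) ∈ S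
  invariant : f '' S = S
  isConnected_diff : IsConnected (S \ {0})
  isSmoothCurve_diff : IsSmoothCurve (S \ {0})
  tendsto_forward : ∀ p ∈ S, Tendsto (fun n : ℤ => (f ^ n) p) atTop (𝓝 0)
  tendsto_backward : ∀ p ∈ S, Tendsto (fun n : ℤ => (f ^ n) p) atBot (𝓝 0)

/-- The bounded part of the complement of `S`: the union of the bounded connected components of
`Sᶜ`.  When `S` is a Jordan curve, as separatrices are, there is exactly one such component. -/
def boundedDomain (S : Set (ℝ × ℝ)) : Set (ℝ × ℝ) :=
  {p | p ∈ Sᶜ ∧ Bornology.IsBounded (connectedComponentIn Sᶜ p)}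

/-- A (topological) circle in the plane: the image of a continuous injective closed curve. -/
def IsCircle (C : Set (ℝ × ℝ)) : Prop :=
  ∃ γ : Circle → ℝ × ℝ, Continuous γ ∧ Function.Injective γ ∧ C = range γ

/-- The Hamiltonian vector field `J ∇H`, with `J = !![0, -1; 1, 0]`. -/
noncomputable def hamVectorField (H : ℝ × ℝ → ℝ) (p : ℝ × ℝ) : ℝ × ℝ :=
  (-(fderiv ℝ H p (0, 1)), fderiv ℝ H p (1, 0))

/-- `g` is the time-`1` map of the (complete) flow of the Hamiltonian vector field of `H`. -/
def IsTimeOneMap (H : ℝ × ℝ → ℝ) (g : ℝ × ℝ → ℝ × ℝ) : Prop :=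
  ∃ Φ : ℝ → ℝ × ℝ → ℝ × ℝ, (∀ p, Φ 0 p = p) ∧
    (∀ t p, HasDerivAt (fun s => Φ s p) (hamVectorField H (Φ t p)) t) ∧
    ∀ p, g p = Φ 1 p

/-- `f` is a local perturbation of the time-`1` map `f₀` of a smooth Hamiltonian `H` which equals
`x y` on a neighbourhood `V` of the origin: `f₀` has `S` as a separatrix, and `f = f₀` outside a
compact subset of `V` which does not contain the origin. -/
def IsLocalPerturbation (f : Equiv.Perm (ℝ × ℝ)) (S : Set (ℝ × ℝ)) : Prop :=
  ∃ (H : ℝ × ℝ → ℝ) (V K : Set (ℝ × ℝ)) (f₀ : Equiv.Perm (ℝ × ℝ)),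
    ContDiff ℝ ∞ H ∧ IsOpen V ∧ 0 ∈ V ∧ (∀ p ∈ V, H p = p.1 * p.2) ∧
    IsTimeOneMap H f₀ ∧ IsSeparatrix f₀ S ∧
    IsCompact K ∧ K ⊆ V \ {0} ∧ ∀ p ∉ K, f p = f₀ p

-- The map is f = Φ₁ ∘ Ψ₁. Here Φ is the flow of `loopHam`. In s = x + y, d = y - x this Hamiltonian
-- reads 4H = U(s) - d², where U = `wellDepth` rises on [0, 9/2] and falls afterwards. The level H =
-- 0, s ≥ 0 is a homoclinic loop Σ, star-shaped about `loopCenter`. Ψ₁ is a kick supported near (0,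
-- 1) that preserves Σ. With energy a = xy and t = log y it acts near (0, 1) as (a, t) ↦ (a/e, et).
--
-- Drift: a point kicked to energy a travels round the loop and comes back near (0, 1) with t' = et
-- + n + log a - L(a), where n counts iterates and L is continuous at 0 (`exists_passage`). Along
-- energies in geometric progression of ratio 1/e, log a drops by exactly 1 per turn, and one extra
-- iterate per turn cancels this. What remains is t' = et + ε with small ε, and expansion yields a
-- bounded solution (`exists_bounded_solution`). Its orbit is kicked on every turn, loses a factor e
-- of energy each time, and tends to Σ (`exists_drifting_orbit`).
--
-- No circle: let C be an invariant circle inside Σ, close to Σ and below the energy of the starting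
-- point z of the drift. The orbit of z accumulates on Σ, so C does not separate z from Σ. The
-- segment from the centre to z has energy at least H(z), so C does not separate the centre from Σ
-- either. Hence the angle seen from the centre is a continuous real function on C, and comparing
-- its extrema gives w ∈ C with f(w) on the ray of w (`exists_same_ray`). But f fixes no point of Σ
-- \ {0} and Σ meets each ray at most once, so f moves points near Σ \ {0} off their rays; near 0
-- the linear saddle does the same (`not_ray_linear`).
--
-- The smooth area-preserving flows come from the Picard equation in a Banach space of curves, where
-- a smooth inverse gives smooth dependence on initial points.

universe u

/-! ### Smoothness of composition operators on spaces of curves -/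

section Superposition

variable {K : Type*} [TopologicalSpace K] [CompactSpace K]
variable {E F : Type u} [NormedAddCommGroup E] [NormedSpace ℝ E]
  [NormedAddCommGroup F] [NormedSpace ℝ F]

/-- A continuous field of operators acts pointwise on continuous functions. -/
noncomputable def pointwiseApply :
    C(K, E →L[ℝ] F) →L[ℝ] C(K, E) →L[ℝ] C(K, F) :=
  LinearMap.mkContinuous₂
    (LinearMap.mk₂ ℝ (fun (A : C(K, E →L[ℝ] F)) (v : C(K, E)) => (⟨fun t => A t (v t), by fun_prop⟩ : C(K, F)))
      (fun _ _ _ => by ext; simp) (fun _ _ _ => by ext; simp)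
      (fun _ _ _ => by ext; simp) (fun _ _ _ => by ext; simp)) 1
    (fun (A : C(K, E →L[ℝ] F)) (v : C(K, E)) => by
      rw [one_mul]
      refine (ContinuousMap.norm_le _ (by positivity)).2 fun t => ?_
      exact (A t).le_of_opNorm_le_of_le (A.norm_coe_le_norm t) (v.norm_coe_le_norm t))

/-- The range of `w` is compact, so one `δ` controls the variation of `X'` around all its points,
even in infinite dimension. The mean value inequality on each `δ`-ball then gives an error uniform
in `t`. -/
lemma hasFDerivAt_superposition {X : C(E, F)} {X' : C(E, E →L[ℝ] F)}
    (h : ∀ a, HasFDerivAt X (X' a) a) (w : C(K, E)) :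
    HasFDerivAt (fun w : C(K, E) => X.comp w) (pointwiseApply (X'.comp w)) w := by
  rw [hasFDerivAt_iff_isLittleO_nhds_zero, Asymptotics.isLittleO_iff]
  intro ε hε
  have hcpt : IsCompact (range w) := isCompact_range w.continuous
  have hu := hcpt.uniformContinuousAt_of_continuousAt X' (fun a _ => X'.continuous.continuousAt)
    (Metric.dist_mem_uniformity hε)
  obtain ⟨δ, hδ, hδ'⟩ := Metric.mem_uniformity_dist.1 hu
  filter_upwards [Metric.ball_mem_nhds (0 : C(K, E)) hδ] with v hv
  rw [mem_ball_zero_iff] at hv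
  refine (ContinuousMap.norm_le _ (by positivity)).2 fun t => ?_
  have hvt : ‖v t‖ < δ := (v.norm_coe_le_norm t).trans_lt hv
  have key := (convex_ball (w t) δ).norm_image_sub_le_of_norm_hasFDerivWithin_le'
    (f := X) (f' := X') (φ := X' (w t)) (C := ε) (x := w t) (y := w t + v t)
    (fun a _ => (h a).hasFDerivWithinAt) (fun a ha => by
      have := hδ' (a := w t) (b := a) (by rw [dist_comm]; exact ha) (mem_range_self t)
      rw [← dist_eq_norm, dist_comm]; exact this.le) (Metric.mem_ball_self hδ)
      (by simpa [dist_eq_norm] using hvt)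
  simp only [add_sub_cancel_left] at key
  exact key.trans (mul_le_mul_of_nonneg_left (v.norm_coe_le_norm t) hε.le)

/-- The derivative is the superposition by `X'` followed by the bounded operator `pointwiseApply`,
so the order of smoothness goes up by induction. The target changes to `E →L[ℝ] F`, which is why `E`
and `F` share a universe. -/
lemma contDiff_superposition_nat (n : ℕ) {F : Type u} [NormedAddCommGroup F] [NormedSpace ℝ F]
    (X : C(E, F)) (hX : ContDiff ℝ n X) : ContDiff ℝ n (fun w : C(K, E) => X.comp w) := by
  induction n generalizing F with
  | zero => exact contDiff_zero.2 (ContinuousMap.continuous_postcomp X)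
  | succ n ih =>
    obtain ⟨X', hX', hd⟩ := contDiff_succ_iff_hasFDerivAt.1 hX
    refine contDiff_succ_iff_hasFDerivAt.2 ⟨_, ?_,
      fun w => hasFDerivAt_superposition (X' := ⟨X', hX'.continuous⟩) hd w⟩
    exact pointwiseApply.contDiff.comp (ih ⟨X', hX'.continuous⟩ hX')

lemma contDiff_superposition (X : C(E, F)) (hX : ContDiff ℝ ∞ X) :
    ContDiff ℝ ∞ (fun w : C(K, E) => X.comp w) :=
  contDiff_infty.2 fun n => contDiff_superposition_nat n X (hX.of_le (by exact_mod_cast le_top))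

end Superposition

/-! ### Smooth inverses of contractive perturbations of the identity -/

section Contraction

variable {V : Type*} [NormedAddCommGroup V] [NormedSpace ℝ V] [CompleteSpace V]

lemma exists_equiv_eq_id_sub {T : V →L[ℝ] V} (hT : ‖T‖ < 1) :
    ∃ e : V ≃L[ℝ] V, (e : V →L[ℝ] V) = ContinuousLinearMap.id ℝ V - T :=
  ⟨ContinuousLinearEquiv.unitsEquiv ℝ V (Units.oneSub T hT), rfl⟩

/-- Lipschitz closeness to the identity makes `id - g` a homeomorphism; its derivative is invertible
by the Neumann series, so the inverse is smooth. -/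
lemma exists_contDiff_inverse_id_sub {g : V → V} {c : NNReal} (hg : ContDiff ℝ ∞ g)
    (hc : LipschitzWith c g) (hc1 : c < 1) :
    ∃ h : V → V, ContDiff ℝ ∞ h ∧ ∀ v, h v - g (h v) = v := by
  have happ : ApproximatesLinearOn (fun v => v - g v)
      (ContinuousLinearEquiv.refl ℝ V : V →L[ℝ] V) univ c := by
    intro v _ w _
    have := hc.dist_le_mul v w
    rw [dist_eq_norm, dist_eq_norm] at this
    have heq : v - g v - (w - g w) - (v - w) = -(g v - g w) := by abel
    change ‖v - g v - (w - g w) - (v - w)‖ ≤ _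
    rwa [heq, norm_neg]
  have hc' : Subsingleton V ∨
      c < ‖((ContinuousLinearEquiv.refl ℝ V).symm : V →L[ℝ] V)‖₊⁻¹ := by
    cases subsingleton_or_nontrivial V with
    | inl h => exact Or.inl h
    | inr h =>
      have : ‖((ContinuousLinearEquiv.refl ℝ V).symm : V →L[ℝ] V)‖₊ = 1 :=
        NNReal.eq ContinuousLinearMap.norm_id
      exact Or.inr (by rwa [this, inv_one])
  let Θ := happ.toHomeomorph _ hc'
  have hnorm : ∀ v, ‖fderiv ℝ g v‖ < 1 := fun v =>
    (norm_fderiv_le_of_lipschitz ℝ hc).trans_lt (by exact_mod_cast hc1)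
  choose e he using fun v => exists_equiv_eq_id_sub (hnorm v)
  have hder : ∀ v, HasFDerivAt Θ (e v : V →L[ℝ] V) v := fun v => by
    rw [he]
    exact (hasFDerivAt_id v).sub ((hg.differentiable (by simp)) v).hasFDerivAt
  exact ⟨Θ.symm, Θ.contDiff_symm hder (contDiff_id.sub hg), fun v => Θ.apply_symm_apply v⟩

end Contraction

/-! ### Global smooth flows of Lipschitz vector fields -/

section Picard

variable {E : Type u} [NormedAddCommGroup E]

/-- The extension of a function on `[-1, 1]` that is constant on both sides. -/
noncomputable def extendIcc (w : C(Icc (-1 : ℝ) 1, E)) : ℝ → E :=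
  IccExtend (by norm_num : (-1 : ℝ) ≤ 1) w

lemma continuous_extendIcc (w : C(Icc (-1 : ℝ) 1, E)) : Continuous (extendIcc w) :=
  w.continuous.Icc_extend'

lemma extendIcc_coe (w : C(Icc (-1 : ℝ) 1, E)) (t : Icc (-1 : ℝ) 1) : extendIcc w t = w t :=
  IccExtend_val _ _ _

lemma norm_extendIcc_le (w : C(Icc (-1 : ℝ) 1, E)) (t : ℝ) : ‖extendIcc w t‖ ≤ ‖w‖ :=
  w.norm_coe_le_norm _

variable [NormedSpace ℝ E]

lemma norm_integral_extendIcc_le (w : C(Icc (-1 : ℝ) 1, E)) (t : Icc (-1 : ℝ) 1) :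
    ‖∫ τ in (0 : ℝ)..t, extendIcc w τ‖ ≤ ‖w‖ := by
  refine (intervalIntegral.norm_integral_le_of_norm_le_const
    (fun τ _ => norm_extendIcc_le w τ)).trans ?_
  have : |(t : ℝ) - 0| ≤ 1 := by rw [sub_zero, abs_le]; exact t.2
  nlinarith [norm_nonneg w]

/-- Integration from `0` as an operator on continuous functions on `[-1, 1]`. -/
noncomputable def volterra : C(Icc (-1 : ℝ) 1, E) →L[ℝ] C(Icc (-1 : ℝ) 1, E) :=
  LinearMap.mkContinuous
    { toFun := fun w => ⟨fun t => ∫ τ in (0 : ℝ)..t, extendIcc w τ,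
        (intervalIntegral.continuous_primitive
          (fun a b => (continuous_extendIcc w).intervalIntegrable a b) 0).comp
          continuous_subtype_val⟩
      map_add' := fun v w => by
        ext t
        exact intervalIntegral.integral_add ((continuous_extendIcc v).intervalIntegrable _ _)
          ((continuous_extendIcc w).intervalIntegrable _ _)
      map_smul' := fun c w => by
        ext t
        exact intervalIntegral.integral_smul c _ } 1
    (fun w => by
      rw [one_mul]
      exact (ContinuousMap.norm_le _ (norm_nonneg _)).2 (norm_integral_extendIcc_le w))

lemma volterra_apply (w : C(Icc (-1 : ℝ) 1, E)) (t : Icc (-1 : ℝ) 1) :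
    volterra w t = ∫ τ in (0 : ℝ)..t, extendIcc w τ := rfl

lemma norm_volterra_le (w : C(Icc (-1 : ℝ) 1, E)) : ‖volterra w‖ ≤ ‖w‖ :=
  (ContinuousMap.norm_le _ (norm_nonneg _)).2 (norm_integral_extendIcc_le w)

lemma contDiff_volterra : ContDiff ℝ ∞ (fun w : C(Icc (-1 : ℝ) 1, E) => volterra w) :=
  ContinuousLinearMap.contDiff (F := C(Icc (-1 : ℝ) 1, E)) volterra

lemma lipschitzWith_volterra_superposition {X : C(E, E)} {c : NNReal} (hc : LipschitzWith c X) :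
    LipschitzWith c (fun w : C(Icc (-1 : ℝ) 1, E) => volterra (X.comp w)) := by
  refine LipschitzWith.of_dist_le_mul fun v w => ?_
  have hsub : volterra (X.comp v) - volterra (X.comp w) = volterra (X.comp v - X.comp w) :=
    ((volterra (E := E)).map_sub (X.comp v) (X.comp w)).symm
  rw [dist_eq_norm, dist_eq_norm, hsub]
  refine (norm_volterra_le _).trans ?_
  refine (ContinuousMap.norm_le _ (by positivity)).2 fun t => ?_
  have := hc.dist_le_mul (v t) (w t)
  rw [dist_eq_norm, dist_eq_norm] at this
  exact this.trans (mul_le_mul_of_nonneg_left ((v - w).norm_coe_le_norm t) c.2)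

/-- Points of the phase space as constant curves. -/
noncomputable def constCurve : E →L[ℝ] C(Icc (-1 : ℝ) 1, E) :=
  LinearMap.mkContinuous
    { toFun := fun p => ContinuousMap.const _ p
      map_add' := fun _ _ => rfl
      map_smul' := fun _ _ => rfl } 1 (fun p => by
        rw [one_mul]
        exact (ContinuousMap.norm_le _ (norm_nonneg _)).2 fun t => le_rfl)

lemma contDiff_constCurve : ContDiff ℝ ∞ (fun p : E => (constCurve p : C(Icc (-1 : ℝ) 1, E))) :=
  ContinuousLinearMap.contDiff (F := C(Icc (-1 : ℝ) 1, E)) constCurve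

variable [CompleteSpace E]

/-- On [-1, 1] the Picard operator contracts with constant `c`. Solving its equation by a smooth
inverse gives existence and smooth dependence on `p` at once. -/
lemma exists_picard_solution {X : C(E, E)} {c : NNReal}
    (hc : LipschitzWith c X) (hc1 : c < 1) (hX : ContDiff ℝ ∞ X) :
    ∃ w : E → C(Icc (-1 : ℝ) 1, E), ContDiff ℝ ∞ w ∧
      ∀ p, w p - volterra (X.comp (w p)) = constCurve p := by
  obtain ⟨h, hh, hh'⟩ := exists_contDiff_inverse_id_sub (V := C(Icc (-1 : ℝ) 1, E))
    (contDiff_volterra.comp (contDiff_superposition X hX))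
    (lipschitzWith_volterra_superposition hc) hc1
  exact ⟨fun p => h (constCurve p), hh.comp contDiff_constCurve, fun p => hh' _⟩

lemma hasDerivAt_volterra (w : C(Icc (-1 : ℝ) 1, E)) {t : ℝ} (ht : t ∈ Ioo (-1 : ℝ) 1) :
    HasDerivAt (extendIcc (volterra w)) (extendIcc w t) t := by
  have h1 : HasDerivAt (fun s => ∫ τ in (0 : ℝ)..s, extendIcc w τ) (extendIcc w t) t :=
    intervalIntegral.integral_hasDerivAt_right
      ((continuous_extendIcc w).intervalIntegrable _ _)
      (continuous_extendIcc w).stronglyMeasurable.stronglyMeasurableAtFilter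
      (continuous_extendIcc w).continuousAt
  refine h1.congr_of_eventuallyEq ?_
  filter_upwards [Ioo_mem_nhds ht.1 ht.2] with s hs
  exact extendIcc_coe (volterra w) ⟨s, hs.1.le, hs.2.le⟩

/-- Local version of the flow theorem, for fields with small Lipschitz constant. -/
lemma exists_local_flow {X : E → E} {c : NNReal}
    (hc : LipschitzWith c X) (hc1 : c < 1) (hX : ContDiff ℝ ∞ X) :
    ∃ φ : ℝ → E → E, (∀ p, φ 0 p = p) ∧
      (∀ t ∈ Ioo (-1 : ℝ) 1, ∀ p, HasDerivAt (fun s => φ s p) (X (φ t p)) t) ∧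
      (∀ t ∈ Ioo (-1 : ℝ) 1, ContDiff ℝ ∞ (φ t)) ∧
      (∀ t ∈ Ioo (-1 : ℝ) 1, ∀ p v, HasDerivAt (fun s => fderiv ℝ (φ s) p v)
        (fderiv ℝ X (φ t p) (fderiv ℝ (φ t) p v)) t) ∧
      ∀ p v, fderiv ℝ (φ 0) p v = v := by
  obtain ⟨w, hw, hw'⟩ := exists_picard_solution (X := ⟨X, hX.continuous⟩) hc hc1 hX
  let ev : ∀ t : ℝ, C(Icc (-1 : ℝ) 1, E) →L[ℝ] E := fun t =>
    ContinuousMap.evalCLM ℝ (projIcc (-1 : ℝ) 1 (by norm_num) t)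
  have hev : ∀ t v, ev t v = extendIcc v t := fun t v => rfl
  have hφsm : ∀ t, ContDiff ℝ ∞ (fun p => extendIcc (w p) t) := fun t =>
    (ev t).contDiff.comp hw
  have hwd : Differentiable ℝ w := hw.differentiable (by simp)
  have hφd : ∀ t p v, fderiv ℝ (fun p => extendIcc (w p) t) p v
      = extendIcc (fderiv ℝ w p v) t := fun t p v => by
    have := ((ev t).hasFDerivAt.comp p (hwd p).hasFDerivAt).fderiv
    change fderiv ℝ (ev t ∘ w) p v = _
    rw [this]; rfl
  have hXd : ∀ a, HasFDerivAt X (fderiv ℝ X a) a := fun a =>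
    (hX.differentiable (by simp) a).hasFDerivAt
  have hX'c : Continuous (fderiv ℝ X) := hX.continuous_fderiv (by simp)
  -- The Picard equation differentiated in `p`: this is the variational equation in integral form.
  have hvar : ∀ p v, fderiv ℝ w p v -
      volterra (pointwiseApply ((⟨fderiv ℝ X, hX'c⟩ : C(E, E →L[ℝ] E)).comp (w p))
        (fderiv ℝ w p v)) = constCurve v := fun p v => by
    have h1 := (hwd p).hasFDerivAt.sub ((volterra (E := E)).hasFDerivAt.comp p
      ((hasFDerivAt_superposition (X := ⟨X, hX.continuous⟩) (X' := ⟨fderiv ℝ X, hX'c⟩) hXd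
        (w p)).comp p (hwd p).hasFDerivAt))
    have h2 : HasFDerivAt (fun p => w p - volterra ((⟨X, hX.continuous⟩ : C(E, E)).comp (w p)))
        constCurve p := by
      simp_rw [hw']; exact (constCurve (E := E)).hasFDerivAt (x := p)
    exact DFunLike.congr_fun (h1.unique h2) v
  have hw1 : ∀ p, w p = constCurve p + volterra ((⟨X, hX.continuous⟩ : C(E, E)).comp (w p)) :=
    fun p => by rw [← hw' p]; abel
  have hv1 : ∀ p v, fderiv ℝ w p v = constCurve v +
      volterra (pointwiseApply ((⟨fderiv ℝ X, hX'c⟩ : C(E, E →L[ℝ] E)).comp (w p))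
        (fderiv ℝ w p v)) := fun p v => by rw [← hvar p v]; abel
  have hvol0 : ∀ v : C(Icc (-1 : ℝ) 1, E), extendIcc (volterra v) 0 = 0 := fun v => by
    have := extendIcc_coe (volterra v) ⟨0, by norm_num⟩
    rw [volterra_apply] at this
    simpa using this
  refine ⟨fun t p => extendIcc (w p) t, fun p => ?_, fun t ht p => ?_, fun t _ => hφsm t,
    fun t ht p v => ?_, fun p v => ?_⟩
  · change ev 0 (w p) = p
    rw [hw1, map_add, hev, hev, hvol0, add_zero]; rfl
  · have h := (hasDerivAt_volterra ((⟨X, hX.continuous⟩ : C(E, E)).comp (w p)) ht).const_add p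
    refine (h.congr_deriv rfl).congr_of_eventuallyEq (Eventually.of_forall fun s => ?_)
    change ev s (w p) = _
    conv_lhs => rw [hw1, map_add]
    rfl
  · simp_rw [hφd]
    have h := (hasDerivAt_volterra
      (pointwiseApply ((⟨fderiv ℝ X, hX'c⟩ : C(E, E →L[ℝ] E)).comp (w p)) (fderiv ℝ w p v))
      ht).const_add v
    refine (h.congr_deriv rfl).congr_of_eventuallyEq (Eventually.of_forall fun s => ?_)
    change ev s (fderiv ℝ w p v) = _
    conv_lhs => rw [hv1, map_add]
    rfl
  · rw [hφd, ← hev, hv1, map_add, hev, hev, hvol0, add_zero]; rfl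

/-- All local solutions live on the same interval (-1, 1), so they extend to all times. -/
lemma exists_global_curve {X : E → E} {c : NNReal}
    (hc : LipschitzWith c X) (hc1 : c < 1) (hX : ContDiff ℝ ∞ X) (p : E) :
    ∃ γ : ℝ → E, γ 0 = p ∧ ∀ t, HasDerivAt γ (X (γ t)) t := by
  obtain ⟨φ, h0, hφ, -⟩ := exists_local_flow hc hc1 hX
  have hv : ContMDiff (modelWithCornersSelf ℝ E) (modelWithCornersSelf ℝ E).tangent 1
      (fun x ↦ (⟨x, X x⟩ : TangentBundle (modelWithCornersSelf ℝ E) E)) :=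
    contMDiff_vectorSpace_iff_contDiff.2 (hX.of_le (by exact_mod_cast le_top))
  obtain ⟨γ, hγ0, hγ⟩ := exists_isMIntegralCurve_of_isMIntegralCurveOn hv one_pos
    (fun q => ⟨fun t => φ t q, h0 q, fun t ht =>
      (hφ t ht q).hasFDerivAt.hasMFDerivAt.hasMFDerivWithinAt⟩) p
  refine ⟨γ, hγ0, fun t => ?_⟩
  have h : HasFDerivAt γ ((1 : ℝ →L[ℝ] ℝ).smulRight (X (γ t))) t := (hγ t).hasFDerivAt
  simpa using h.hasDerivAt

/-- Flow theorem for fields with small Lipschitz constant: the flow is global, smooth, and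
preserves every bilinear form that is infinitesimally preserved. -/
lemma exists_flow_of_lipschitz_lt_one {X : E → E} {c : NNReal}
    (hc : LipschitzWith c X) (hc1 : c < 1) (hX : ContDiff ℝ ∞ X) :
    ∃ φ : ℝ → E → E, (∀ p, φ 0 p = p) ∧
      (∀ t p, HasDerivAt (fun s => φ s p) (X (φ t p)) t) ∧
      (∀ s t p, φ (s + t) p = φ s (φ t p)) ∧
      (∀ t, ContDiff ℝ ∞ (φ t)) ∧
      ∀ B : E →L[ℝ] E →L[ℝ] ℝ,
        (∀ p u v, B (fderiv ℝ X p u) v + B u (fderiv ℝ X p v) = 0) →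
        ∀ t p u v, B (fderiv ℝ (φ t) p u) (fderiv ℝ (φ t) p v) = B u v := by
  obtain ⟨ψ, ψ0, hψ, hψs, hψv, hψ0⟩ := exists_local_flow hc hc1 hX
  choose γ γ0 hγ using exists_global_curve hc hc1 hX
  have hlip : ∀ _ : ℝ, LipschitzOnWith c X univ := fun _ => hc.lipschitzOnWith
  have hadd : ∀ s t p, γ p (s + t) = γ (γ p t) s := fun s t p => by
    have := ODE_solution_unique_univ (t₀ := 0) hlip
      (f := fun s => γ p (s + t)) (g := γ (γ p t))
      (fun r => ⟨(hγ p (r + t)).comp_add_const r t, trivial⟩)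
      (fun r => ⟨hγ _ r, trivial⟩) (by simp [γ0])
    exact congrFun this s
  have hloc : ∀ t ∈ Ioo (-1 : ℝ) 1, (fun p => γ p t) = ψ t := fun t ht => by
    funext p
    exact ODE_solution_unique_of_mem_Ioo (t₀ := 0) (fun t _ => hlip t) (by norm_num)
      (f := γ p) (g := fun s => ψ s p) (fun r _ => ⟨hγ p r, trivial⟩)
      (fun r hr => ⟨hψ r hr p, trivial⟩) (by simp [γ0, ψ0]) ht
  -- Time `t` splits into `n` equal steps shorter than 1, so any property stable under composition
  -- passes from the local flow to the global one.
  have hind : ∀ P : (E → E) → Prop, P id → (∀ f g, P f → P g → P (f ∘ g)) →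
      (∀ t ∈ Ioo (-1 : ℝ) 1, P (ψ t)) → ∀ t, P (fun p => γ p t) := by
    intro P hid hcomp hsmall t
    obtain ⟨n, hn⟩ := exists_nat_gt |t|
    have hn0 : (0 : ℝ) < n := (abs_nonneg t).trans_lt hn
    have hτ : t / n ∈ Ioo (-1 : ℝ) 1 := by
      rw [mem_Ioo, ← abs_lt, abs_div, Nat.abs_cast, div_lt_one hn0]; exact hn
    have hk : ∀ k : ℕ, P (fun p => γ p (k * (t / n))) := by
      intro k
      induction k with
      | zero =>
        have : (fun p => γ p ((0 : ℕ) * (t / n))) = id := by funext p; simp [γ0]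
        rwa [this]
      | succ k ih =>
        have : (fun p => γ p ((k + 1 : ℕ) * (t / n))) =
            (fun p => γ p (k * (t / n))) ∘ (fun p => γ p (t / n)) := by
          funext p
          simp only [Function.comp_apply]
          rw [← hadd]; push_cast; ring_nf
        rw [this, hloc _ hτ]
        exact hcomp _ _ ih (hsmall _ hτ)
    have := hk n
    rwa [mul_div_cancel₀ _ hn0.ne'] at this
  have hsm : ∀ t, ContDiff ℝ ∞ (fun p => γ p t) :=
    hind (fun f => ContDiff ℝ ∞ f) contDiff_id (fun f g hf hg => hf.comp hg) hψs
  refine ⟨fun t p => γ p t, γ0, fun t p => hγ p t, hadd, hsm, fun B hB t => ?_⟩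
  refine (hind (fun f => ContDiff ℝ ∞ f ∧ ∀ p u v, B (fderiv ℝ f p u) (fderiv ℝ f p v) = B u v)
    ⟨contDiff_id, fun p u v => by simp⟩ (fun f g hf hg => ⟨hf.1.comp hg.1, fun p u v => ?_⟩)
    (fun t ht => ⟨hψs t ht, fun p u v => ?_⟩) t).2
  · rw [fderiv_comp p (hf.1.differentiable (by simp) _) (hg.1.differentiable (by simp) _)]
    simp only [ContinuousLinearMap.comp_apply]
    rw [hf.2, hg.2]
  -- By the variational equation the pulled-back form has zero time derivative, so it keeps its
  -- value at time 0.
  · have hder : ∀ s ∈ Ioo (-1 : ℝ) 1,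
        HasDerivAt (fun s => B (fderiv ℝ (ψ s) p u) (fderiv ℝ (ψ s) p v)) 0 s := fun s hs => by
      have h1 := (B.hasFDerivAt.comp_hasDerivAt s (hψv s hs p u)).clm_apply (hψv s hs p v)
      refine h1.congr_deriv ?_
      exact hB _ _ _
    have hconst := (convex_Ioo (-1 : ℝ) 1).is_const_of_fderivWithin_eq_zero (𝕜 := ℝ)
      (f := fun s => B (fderiv ℝ (ψ s) p u) (fderiv ℝ (ψ s) p v))
      (fun s hs => (hder s hs).differentiableAt.differentiableWithinAt)
      (fun s hs => by
        rw [((hder s hs).hasFDerivAt.hasFDerivWithinAt).fderivWithin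
          (isOpen_Ioo.uniqueDiffWithinAt hs)]
        ext; simp) ht (by norm_num : (0 : ℝ) ∈ Ioo (-1 : ℝ) 1)
    simpa [hψ0] using hconst

/-- Flow theorem for smooth globally Lipschitz vector fields: the flow is global, smooth, and
preserves every bilinear form that is infinitesimally preserved. -/
theorem exists_flow_of_lipschitz {X : E → E} {c : NNReal}
    (hc : LipschitzWith c X) (hX : ContDiff ℝ ∞ X) :
    ∃ φ : ℝ → E → E, (∀ p, φ 0 p = p) ∧
      (∀ t p, HasDerivAt (fun s => φ s p) (X (φ t p)) t) ∧
      (∀ s t p, φ (s + t) p = φ s (φ t p)) ∧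
      (∀ t, ContDiff ℝ ∞ (φ t)) ∧
      ∀ B : E →L[ℝ] E →L[ℝ] ℝ,
        (∀ p u v, B (fderiv ℝ X p u) v + B u (fderiv ℝ X p v) = 0) →
        ∀ t p u v, B (fderiv ℝ (φ t) p u) (fderiv ℝ (φ t) p v) = B u v := by
  have hr : (0 : ℝ) < c + 1 := by positivity
  -- Slowing time by `r` brings the Lipschitz constant down to c/(c + 1) < 1; the slowed flow is
  -- then read at time `t / r`.
  set r : ℝ := (c + 1 : ℝ)⁻¹ with hrdef
  have hr0 : 0 < r := inv_pos.2 hr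
  have hlip : LipschitzWith (c / (c + 1)) (fun p => r • X p) := by
    refine LipschitzWith.of_dist_le_mul fun p q => ?_
    rw [dist_smul₀, Real.norm_of_nonneg hr0.le]
    calc r * dist (X p) (X q) ≤ r * (c * dist p q) := by gcongr; exact hc.dist_le_mul p q
      _ = _ := by push_cast; rw [hrdef]; ring
  have hlt : c / (c + 1) < 1 := by
    rw [div_lt_one (by positivity)]
    exact lt_add_one c
  obtain ⟨φ, h0, hd, hadd, hs, hB⟩ := exists_flow_of_lipschitz_lt_one hlip hlt (hX.const_smul r)
  refine ⟨fun t => φ (t / r), by simpa using h0, fun t p => ?_, fun s t p => ?_,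
    fun t => hs _, fun B h t p u v => hB B (fun p u v => ?_) _ p u v⟩
  · have := (hd (t / r) p).scomp t ((hasDerivAt_id t).div_const r)
    refine this.congr_deriv ?_
    rw [smul_smul, one_div, inv_mul_cancel₀ hr0.ne', one_smul]
  · simp only [add_div, hadd]
  · rw [fderiv_fun_const_smul (hX.differentiable (by simp) p)]
    simp only [smul_apply, map_smul, smul_eq_mul]
    rw [← mul_add, h, mul_zero]

end Picard

/-! ### Continuous logarithms and points kept on their ray -/

/-- The identification of the plane with `ℂ`. -/
noncomputable def planeToComplex : (ℝ × ℝ) ≃L[ℝ] ℂ := Complex.equivRealProdCLM.symm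

/-- The function `w ↦ w - p` has a continuous logarithm on `C`. -/
def HasLogOn (C : Set (ℝ × ℝ)) (p : ℝ × ℝ) : Prop :=
  ∃ L : ℝ × ℝ → ℂ, ContinuousOn L C ∧ ∀ w ∈ C, Complex.exp (L w) = planeToComplex (w - p)

/-- Factor w - p = (w - q)(1 + (q - p)/(w - q)); the last factor is within 1 of 1, where the
principal logarithm is continuous. -/
lemma HasLogOn.of_lt {C : Set (ℝ × ℝ)} {p q : ℝ × ℝ} (h : HasLogOn C q)
    (hpq : ∀ w ∈ C, ‖planeToComplex (q - p)‖ < ‖planeToComplex (w - q)‖) : HasLogOn C p := by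
  obtain ⟨L, hL, hexp⟩ := h
  have hne : ∀ w ∈ C, planeToComplex (w - q) ≠ 0 := fun w hw =>
    norm_pos_iff.1 ((norm_nonneg _).trans_lt (hpq w hw))
  have hslit : ∀ w ∈ C, 1 + planeToComplex (q - p) / planeToComplex (w - q) ∈
      Complex.slitPlane := fun w hw => by
    apply Complex.mem_slitPlane_of_norm_lt_one
    rw [norm_div, div_lt_one (norm_pos_iff.2 (hne w hw))]
    exact hpq w hw
  refine ⟨fun w => L w + Complex.log (1 + planeToComplex (q - p) / planeToComplex (w - q)),
    hL.add (ContinuousOn.clog ?_ hslit), fun w hw => ?_⟩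
  · refine continuousOn_const.add (continuousOn_const.div ?_ hne)
    exact (planeToComplex.continuous.comp (continuous_id.sub continuous_const)).continuousOn
  · rw [Complex.exp_add, hexp w hw, Complex.exp_log (Complex.slitPlane_ne_zero (hslit w hw)),
      mul_add, mul_div_cancel₀ _ (hne w hw), mul_one, ← map_add]
    congr 1
    abel

/-- If `q` is closer to `p` than half the distance from `p` to `C`, then `HasLogOn.of_lt` applies in
both directions. This local constancy replaces that of the winding number. -/
lemma eventually_hasLogOn_iff {C : Set (ℝ × ℝ)} (hC : IsCompact C) {p : ℝ × ℝ} (hp : p ∉ C) :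
    ∀ᶠ q in 𝓝 p, HasLogOn C q ↔ HasLogOn C p := by
  rcases C.eq_empty_or_nonempty with rfl | hne
  · exact Eventually.of_forall fun q =>
      ⟨fun _ => ⟨0, continuousOn_const, by simp⟩, fun _ => ⟨0, continuousOn_const, by simp⟩⟩
  have hcont : Continuous fun w : ℝ × ℝ => ‖planeToComplex (w - p)‖ := by fun_prop
  obtain ⟨w₀, hw₀, hmin⟩ := hC.exists_isMinOn hne hcont.continuousOn
  have hpos : 0 < ‖planeToComplex (w₀ - p)‖ := by
    rw [norm_pos_iff]
    intro h
    rw [map_eq_zero_iff _ planeToComplex.injective, sub_eq_zero] at h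
    exact hp (h ▸ hw₀)
  have hev : ∀ᶠ q in 𝓝 p, ‖planeToComplex (q - p)‖ < ‖planeToComplex (w₀ - p)‖ / 2 := by
    refine hcont.continuousAt.eventually_lt continuousAt_const ?_
    simpa using hpos.ne'
  filter_upwards [hev] with q hq
  refine ⟨fun h => h.of_lt fun w hw => ?_, fun h => h.of_lt fun w hw => ?_⟩
  · have h1 : ‖planeToComplex (w₀ - p)‖ ≤ ‖planeToComplex (w - p)‖ := hmin hw
    have h2 : planeToComplex (w - p) = planeToComplex (w - q) + planeToComplex (q - p) := by
      rw [← map_add]; congr 1; abel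
    have h3 := norm_add_le (planeToComplex (w - q)) (planeToComplex (q - p))
    rw [← h2] at h3
    linarith
  · have h1 : ‖planeToComplex (w₀ - p)‖ ≤ ‖planeToComplex (w - p)‖ := hmin hw
    rw [← neg_sub q p, map_neg, norm_neg]
    linarith

lemma HasLogOn.of_mem_connectedComponentIn {C : Set (ℝ × ℝ)} (hC : IsCompact C) {p q : ℝ × ℝ}
    (h : HasLogOn C p) (hq : q ∈ connectedComponentIn Cᶜ p) : HasLogOn C q := by
  by_contra hcon
  have hpC : p ∈ Cᶜ := by
    by_contra hp
    rw [connectedComponentIn_eq_empty hp] at hq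
    exact hq
  have hqC : q ∈ Cᶜ := connectedComponentIn_subset _ _ hq
  obtain ⟨r, -, hr1, hr2⟩ := isPreconnected_connectedComponentIn (F := Cᶜ) (x := p)
    {r | ∀ᶠ s in 𝓝 r, HasLogOn C s} {r | ∀ᶠ s in 𝓝 r, ¬ HasLogOn C s}
    isOpen_setOfPred_eventually_nhds isOpen_setOfPred_eventually_nhds
    (fun r hr => by
      have hr' := eventually_hasLogOn_iff hC (connectedComponentIn_subset _ _ hr)
      by_cases hrl : HasLogOn C r
      · exact Or.inl (hr'.mono fun s hs => hs.2 hrl)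
      · exact Or.inr (hr'.mono fun s hs hs' => hrl (hs.1 hs')))
    ⟨p, mem_connectedComponentIn hpC, (eventually_hasLogOn_iff hC hpC).mono fun s hs => hs.2 h⟩
    ⟨q, hq, (eventually_hasLogOn_iff hC hqC).mono fun s hs hs' => hcon (hs.1 hs')⟩
  exact hr2.self_of_nhds hr1.self_of_nhds

/-- Multiplication by 1 - i carries the half-plane x + y > 0 to the right half-plane. -/
lemma hasLogOn_zero {C : Set (ℝ × ℝ)} (h : ∀ w ∈ C, 0 < w.1 + w.2) : HasLogOn C 0 := by
  have hI : ∀ w ∈ C, planeToComplex w * (1 - Complex.I) ∈ Complex.slitPlane := fun w hw => by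
    refine Or.inl ?_
    have h1 : (planeToComplex w).re = w.1 := rfl
    have h2 : (planeToComplex w).im = w.2 := rfl
    simp only [Complex.mul_re, Complex.sub_re, Complex.sub_im, Complex.one_re, Complex.one_im,
      Complex.I_re, Complex.I_im, h1, h2]
    linarith [h w hw]
  have hne : (1 - Complex.I) ≠ 0 := by
    intro h
    simpa using congrArg Complex.re h
  refine ⟨fun w => Complex.log (planeToComplex w * (1 - Complex.I)) - Complex.log (1 - Complex.I),
    (ContinuousOn.clog (by fun_prop) hI).sub continuousOn_const, fun w hw => ?_⟩
  rw [Complex.exp_sub, Complex.exp_log (Complex.slitPlane_ne_zero (hI w hw)), Complex.exp_log hne,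
    mul_div_cancel_right₀ _ hne, sub_zero]

/-- A continuous self-map of a compact connected set `C` that does not separate `p` from the
origin, where `C` lies on one side of a line through the origin, maps some point of `C` to a point
on the same ray issued from `p`. -/
theorem exists_same_ray {C : Set (ℝ × ℝ)} (hC : IsCompact C) (hconn : IsConnected C)
    {g : ℝ × ℝ → ℝ × ℝ} (hg : ContinuousOn g C) (hgC : MapsTo g C C)
    (hpos : ∀ w ∈ C, 0 < w.1 + w.2) {p : ℝ × ℝ} (hp : p ∈ connectedComponentIn Cᶜ 0) :
    ∃ w ∈ C, ∃ r : ℝ, 0 < r ∧ g w - p = r • (w - p) := by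
  obtain ⟨L, hL, hexp⟩ := (hasLogOn_zero hpos).of_mem_connectedComponentIn hC hp
  have hθ : ContinuousOn (fun w => (L w).im) C := Complex.continuous_im.comp_continuousOn hL
  have hδ : ContinuousOn (fun w => (L (g w)).im - (L w).im) C := (hθ.comp hg hgC).sub hθ
  obtain ⟨a, ha, hmax⟩ := hC.exists_isMaxOn hconn.nonempty hθ
  obtain ⟨b, hb, hmin⟩ := hC.exists_isMinOn hconn.nonempty hθ
  -- The angle cannot increase at its maximum nor decrease at its minimum, so its increment under
  -- `g` vanishes somewhere on the connected set `C`.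
  obtain ⟨w, hw, h0⟩ : (0 : ℝ) ∈ (fun w => (L (g w)).im - (L w).im) '' C :=
    hconn.isPreconnected.intermediate_value ha hb hδ
      ⟨sub_nonpos.2 (hmax (hgC ha)), sub_nonneg.2 (hmin (hgC hb))⟩
  refine ⟨w, hw, Real.exp ((L (g w)).re - (L w).re), Real.exp_pos _, ?_⟩
  apply planeToComplex.injective
  rw [map_smul, ← hexp w hw, ← hexp _ (hgC hw), Complex.real_smul, Complex.ofReal_exp,
    ← Complex.exp_add]
  congr 1
  have h0' : (L (g w)).im - (L w).im = 0 := h0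
  apply Complex.ext
  · simp
  · simp; linarith

/-! ### The potential well that closes the loop -/

section Turn

/-- The force that bends the linear saddle back to itself. -/
noncomputable def turnForce (s : ℝ) : ℝ := s * Real.smoothTransition (s - 4)

lemma contDiff_turnForce : ContDiff ℝ ∞ turnForce :=
  contDiff_id.mul (Real.smoothTransition.contDiff.comp (contDiff_id.sub contDiff_const))

lemma continuous_turnForce : Continuous turnForce := contDiff_turnForce.continuous

lemma turnForce_of_le {s : ℝ} (h : s ≤ 4) : turnForce s = 0 := by
  rw [turnForce, Real.smoothTransition.zero_of_nonpos (by linarith), mul_zero]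

lemma turnForce_of_ge {s : ℝ} (h : 5 ≤ s) : turnForce s = s := by
  rw [turnForce, Real.smoothTransition.one_of_one_le (by linarith), mul_one]

lemma turnForce_nonneg {s : ℝ} (h : 0 ≤ s) : 0 ≤ turnForce s :=
  mul_nonneg h (Real.smoothTransition.nonneg _)

lemma expNegInvGlue_lt {x y : ℝ} (h : x < y) (hy : 0 < y) :
    expNegInvGlue x < expNegInvGlue y := by
  rcases le_or_gt x 0 with hx | hx
  · rw [expNegInvGlue.zero_of_nonpos hx]
    exact expNegInvGlue.pos_of_pos hy
  · rw [expNegInvGlue, expNegInvGlue, if_neg hx.not_ge, if_neg hy.not_ge, Real.exp_lt_exp,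
      neg_lt_neg_iff]
    exact inv_strictAnti₀ hx h

/-- The transition is the share of e(x) in e(x) + e(1 - x), with e increasing, so it crosses 1/2
exactly at x = 1/2. This puts the equilibrium of the Newton equation at s = 9/2. -/
lemma smoothTransition_lt_half {x : ℝ} (h : x < 1 / 2) : Real.smoothTransition x < 1 / 2 := by
  have h1 := expNegInvGlue_lt (x := x) (y := 1 - x) (by linarith) (by linarith)
  rw [Real.smoothTransition, div_lt_iff₀ (Real.smoothTransition.pos_denom x)]
  linarith

lemma half_lt_smoothTransition {x : ℝ} (h : 1 / 2 < x) : 1 / 2 < Real.smoothTransition x := by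
  have h1 := expNegInvGlue_lt (x := 1 - x) (y := x) (by linarith) (by linarith)
  rw [Real.smoothTransition, lt_div_iff₀ (Real.smoothTransition.pos_denom x)]
  linarith

lemma two_mul_turnForce_lt {s : ℝ} (h0 : 0 < s) (h : s < 9 / 2) : 2 * turnForce s < s := by
  have := smoothTransition_lt_half (x := s - 4) (by linarith)
  rw [turnForce]; nlinarith

lemma lt_two_mul_turnForce {s : ℝ} (h : 9 / 2 < s) : s < 2 * turnForce s := by
  have := half_lt_smoothTransition (x := s - 4) (by linarith)
  rw [turnForce]; nlinarith

/-- The derivative is 0 below 4, 1 above 5, and bounded between by compactness. The global bound is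
what makes the Hamiltonian flow complete. -/
lemma exists_lipschitzWith_turnForce : ∃ c, LipschitzWith c turnForce := by
  have hcont : Continuous (deriv turnForce) := contDiff_turnForce.continuous_deriv (by simp)
  obtain ⟨C, hC⟩ := (isCompact_Icc (a := (3 : ℝ)) (b := 6)).exists_bound_of_continuousOn
    hcont.continuousOn
  have hC0 : 0 ≤ C := (norm_nonneg _).trans (hC 4 (by norm_num))
  refine ⟨Real.toNNReal (C + 1), lipschitzWith_of_nnnorm_deriv_le
    (contDiff_turnForce.differentiable (by simp)) fun s => ?_⟩
  rw [← NNReal.coe_le_coe, coe_nnnorm, Real.coe_toNNReal _ (by positivity)]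
  by_cases hs : s ∈ Icc (3 : ℝ) 6
  · linarith [hC s hs]
  · rw [mem_Icc, not_and_or, not_le, not_le] at hs
    rcases hs with hs | hs
    · have : turnForce =ᶠ[𝓝 s] fun _ => 0 := by
        filter_upwards [Iio_mem_nhds hs] with t ht
        exact turnForce_of_le (by linarith [mem_Iio.1 ht])
      rw [this.deriv_eq, deriv_const, norm_zero]
      positivity
    · have : turnForce =ᶠ[𝓝 s] id := by
        filter_upwards [Ioi_mem_nhds hs] with t ht
        exact turnForce_of_ge (by linarith [mem_Ioi.1 ht])
      rw [this.deriv_eq, deriv_id, norm_one]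
      linarith

/-- The primitive of `turnForce`. -/
noncomputable def turnPot (s : ℝ) : ℝ := ∫ τ in (0 : ℝ)..s, turnForce τ

lemma hasDerivAt_turnPot (s : ℝ) : HasDerivAt turnPot (turnForce s) s :=
  continuous_turnForce.integral_hasStrictDerivAt 0 s |>.hasDerivAt

lemma contDiff_turnPot : ContDiff ℝ ∞ turnPot := by
  rw [contDiff_infty_iff_deriv]
  refine ⟨fun s => (hasDerivAt_turnPot s).differentiableAt, ?_⟩
  rw [funext fun s => (hasDerivAt_turnPot s).deriv]
  exact contDiff_turnForce

lemma turnPot_zero : turnPot 0 = 0 := intervalIntegral.integral_same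

lemma turnPot_of_le {s : ℝ} (h : s ≤ 4) : turnPot s = 0 := by
  refine intervalIntegral.integral_zero_ae (Eventually.of_forall fun τ hτ => ?_)
  refine turnForce_of_le (hτ.2.trans ?_)
  exact max_le (by norm_num) h

lemma turnPot_nonneg {s : ℝ} (h : 0 ≤ s) : 0 ≤ turnPot s :=
  intervalIntegral.integral_nonneg h fun _ hτ => turnForce_nonneg hτ.1

/-- Minus the potential energy of the Newton equation `s'' = s - 2 * turnForce s`, up to a
factor. -/
noncomputable def wellDepth (s : ℝ) : ℝ := s ^ 2 - 4 * turnPot s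

lemma hasDerivAt_wellDepth (s : ℝ) : HasDerivAt wellDepth (2 * (s - 2 * turnForce s)) s := by
  have := ((hasDerivAt_id s).pow 2).sub ((hasDerivAt_turnPot s).const_mul 4)
  refine this.congr_deriv ?_
  simp; ring

lemma continuous_wellDepth : Continuous wellDepth :=
  continuous_iff_continuousAt.2 fun s => (hasDerivAt_wellDepth s).continuousAt

lemma wellDepth_zero : wellDepth 0 = 0 := by simp [wellDepth, turnPot_zero]

lemma wellDepth_le {s : ℝ} (h : 0 ≤ s) : wellDepth s ≤ s ^ 2 := by
  have := turnPot_nonneg h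
  rw [wellDepth]; linarith

lemma strictMonoOn_wellDepth : StrictMonoOn wellDepth (Icc 0 (9 / 2)) := by
  refine strictMonoOn_of_deriv_pos (convex_Icc _ _) continuous_wellDepth.continuousOn
    fun s hs => ?_
  rw [interior_Icc] at hs
  rw [(hasDerivAt_wellDepth s).deriv]
  linarith [two_mul_turnForce_lt hs.1 hs.2]

lemma strictAntiOn_wellDepth : StrictAntiOn wellDepth (Ici (9 / 2)) := by
  refine strictAntiOn_of_deriv_neg (convex_Ici _) continuous_wellDepth.continuousOn
    fun s hs => ?_
  rw [interior_Ici] at hs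
  rw [(hasDerivAt_wellDepth s).deriv]
  linarith [lt_two_mul_turnForce hs]

/-- Beyond 5 the force equals s, so U + s² does not increase there; with U(5) ≤ 25 this gives U(s) ≤
50 - s². -/
lemma wellDepth_neg {s : ℝ} (h : 8 ≤ s) : wellDepth s < 0 := by
  have hanti : AntitoneOn (fun s => wellDepth s + s ^ 2) (Ici 5) := by
    have hd : ∀ s : ℝ, HasDerivAt (fun s => wellDepth s + s ^ 2)
        (2 * (s - 2 * turnForce s) + 2 * s) s := fun s => by
      refine ((hasDerivAt_wellDepth s).add ((hasDerivAt_id s).pow 2)).congr_deriv ?_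
      simp
    refine antitoneOn_of_deriv_nonpos (convex_Ici _)
      (continuous_wellDepth.add (continuous_pow 2)).continuousOn
      (fun s _ => (hd s).differentiableAt.differentiableWithinAt) fun s hs => ?_
    rw [interior_Ici] at hs
    rw [(hd s).deriv, turnForce_of_ge (le_of_lt hs)]
    linarith
  have h1 := hanti (mem_Ici.2 (le_refl (5 : ℝ))) (show s ∈ Ici 5 by
    rw [mem_Ici]; linarith) (by linarith)
  have h2 := wellDepth_le (s := 5) (by norm_num)
  simp only at h1
  nlinarith

lemma wellDepth_pos {s : ℝ} (h0 : 0 < s) (h : s ≤ 9 / 2) : 0 < wellDepth s := by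
  have := strictMonoOn_wellDepth (show (0 : ℝ) ∈ Icc 0 (9 / 2) by norm_num) ⟨h0.le, h⟩ h0
  rwa [wellDepth_zero] at this

/-- The turning point: the loop crosses the diagonal x = y at s = σ. -/
lemma exists_wellDepth_zero : ∃ σ : ℝ, 9 / 2 < σ ∧ σ < 8 ∧ wellDepth σ = 0 ∧
    (∀ s, 0 < s → s < σ → 0 < wellDepth s) ∧ ∀ s, σ < s → wellDepth s < 0 := by
  obtain ⟨σ, hσ, h0⟩ : (0 : ℝ) ∈ wellDepth '' Icc (9 / 2) 8 :=
    intermediate_value_Icc' (by norm_num) continuous_wellDepth.continuousOn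
      ⟨(wellDepth_neg le_rfl).le, (wellDepth_pos (by norm_num) le_rfl).le⟩
  have h1 : σ ≠ 9 / 2 := by
    rintro rfl; exact (wellDepth_pos (by norm_num) le_rfl).ne' h0
  have h2 : σ ≠ 8 := by rintro rfl; exact (wellDepth_neg le_rfl).ne h0
  refine ⟨σ, lt_of_le_of_ne hσ.1 h1.symm, lt_of_le_of_ne hσ.2 h2, h0, fun s hs hsσ => ?_,
    fun s hs => ?_⟩
  · rcases le_or_gt s (9 / 2) with h | h
    · exact wellDepth_pos hs h
    · rw [← h0]; exact strictAntiOn_wellDepth h.le hσ.1 hsσ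
  · rw [← h0]; exact strictAntiOn_wellDepth hσ.1 (hσ.1.trans hs.le) hs

end Turn

/-! ### The homoclinic loop and its interior -/

section Hamiltonian

/-- The Hamiltonian: equal to `x * y` where `x + y ≤ 4`, with a homoclinic loop. -/
noncomputable def loopHam (p : ℝ × ℝ) : ℝ := p.1 * p.2 - turnPot (p.1 + p.2)

lemma contDiff_loopHam : ContDiff ℝ ∞ loopHam :=
  (contDiff_fst.mul contDiff_snd).sub (contDiff_turnPot.comp (contDiff_fst.add contDiff_snd))

lemma continuous_loopHam : Continuous loopHam := contDiff_loopHam.continuous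

/-- Separation of variables: the geometry of the level sets reduces to the shape of the one-variable
function `wellDepth`. -/
lemma four_mul_loopHam (p : ℝ × ℝ) :
    4 * loopHam p = wellDepth (p.1 + p.2) - (p.2 - p.1) ^ 2 := by
  rw [loopHam, wellDepth]; ring

lemma loopHam_of_le {p : ℝ × ℝ} (h : p.1 + p.2 ≤ 4) : loopHam p = p.1 * p.2 := by
  rw [loopHam, turnPot_of_le h, sub_zero]

lemma hasFDerivAt_loopHam (p : ℝ × ℝ) :
    HasFDerivAt loopHam
      ((p.2 - turnForce (p.1 + p.2)) • ContinuousLinearMap.fst ℝ ℝ ℝ +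
        (p.1 - turnForce (p.1 + p.2)) • ContinuousLinearMap.snd ℝ ℝ ℝ) p := by
  have h1 : HasFDerivAt (fun p : ℝ × ℝ => p.1) (ContinuousLinearMap.fst ℝ ℝ ℝ) p := hasFDerivAt_fst
  have h2 : HasFDerivAt (fun p : ℝ × ℝ => p.2) (ContinuousLinearMap.snd ℝ ℝ ℝ) p := hasFDerivAt_snd
  refine ((h1.mul h2).sub ((hasDerivAt_turnPot (p.1 + p.2)).comp_hasFDerivAt p
    (h1.add h2))).congr_fderiv ?_
  ext <;> simp

lemma hamVectorField_loopHam (p : ℝ × ℝ) :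
    hamVectorField loopHam p = (turnForce (p.1 + p.2) - p.1, p.2 - turnForce (p.1 + p.2)) := by
  rw [hamVectorField, (hasFDerivAt_loopHam p).fderiv]
  simp

/-- The homoclinic loop. -/
def loop : Set (ℝ × ℝ) := {p | loopHam p = 0 ∧ 0 ≤ p.1 + p.2}

/-- The domain bounded by the homoclinic loop. -/
def loopInterior : Set (ℝ × ℝ) := {p | 0 < loopHam p ∧ 0 < p.1 + p.2}

lemma eq_zero_of_mem_loop {p : ℝ × ℝ} (h : 0 ≤ loopHam p) (hs : p.1 + p.2 = 0) : p = 0 := by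
  have := four_mul_loopHam p
  rw [hs, wellDepth_zero] at this
  have h1 : (p.2 - p.1) ^ 2 ≤ 0 := by linarith
  have h2 : p.2 - p.1 = 0 := by nlinarith
  apply Prod.ext
  · change p.1 = 0; linarith
  · change p.2 = 0; linarith

lemma loopHam_zero : loopHam 0 = 0 := by simp [loopHam, turnPot_zero]

lemma zero_mem_loop : (0 : ℝ × ℝ) ∈ loop := ⟨loopHam_zero, by simp⟩

lemma mem_loop_diff_zero {p : ℝ × ℝ} :
    p ∈ loop \ {0} ↔ loopHam p = 0 ∧ 0 < p.1 + p.2 := by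
  constructor
  · rintro ⟨⟨h, hs⟩, hp⟩
    exact ⟨h, lt_of_le_of_ne hs fun h0 => hp (eq_zero_of_mem_loop h.ge h0.symm)⟩
  · rintro ⟨h, hs⟩
    refine ⟨⟨h, hs.le⟩, ?_⟩
    rintro rfl
    simp at hs

lemma mem_box_of_loopHam_nonneg {p : ℝ × ℝ} (h : 0 ≤ loopHam p) (hs : 0 ≤ p.1 + p.2) :
    p ∈ Icc (-8 : ℝ) 8 ×ˢ Icc (-8 : ℝ) 8 := by
  have h4 := four_mul_loopHam p
  have h8 : p.1 + p.2 < 8 := by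
    by_contra hcon
    have := wellDepth_neg (not_lt.1 hcon)
    nlinarith [sq_nonneg (p.2 - p.1)]
  have h1 := wellDepth_le hs
  have h2 : |p.2 - p.1| ≤ p.1 + p.2 := abs_le_of_sq_le_sq (by linarith) hs
  rw [abs_le] at h2
  refine ⟨⟨?_, ?_⟩, ?_, ?_⟩ <;> linarith

lemma isCompact_loop : IsCompact loop := by
  refine (isCompact_Icc.prod isCompact_Icc).of_isClosed_subset ?_
    fun p hp => mem_box_of_loopHam_nonneg hp.1.ge hp.2
  exact (isClosed_eq continuous_loopHam continuous_const).inter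
    (isClosed_le continuous_const (continuous_fst.add continuous_snd))

lemma isConnected_loop_diff : IsConnected (loop \ {0}) := by
  obtain ⟨σ, h1, h2, h0, hpos, hneg⟩ := exists_wellDepth_zero
  -- The two branches d = ±√U(s) over (0, σ], which meet at s = σ.
  let br : ℝ → ℝ → ℝ × ℝ := fun e s => ((s - e * √(wellDepth s)) / 2, (s + e * √(wellDepth s)) / 2)
  have hbr : ∀ e, Continuous (br e) := fun e => by
    have := continuous_wellDepth
    fun_prop
  have hnn : ∀ s ∈ Ioc 0 σ, 0 ≤ wellDepth s := fun s hs => by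
    rcases hs.2.lt_or_eq with h | h
    · exact (hpos s hs.1 h).le
    · rw [h, h0]
  have himg : loop \ {0} = br 1 '' Ioc 0 σ ∪ br (-1) '' Ioc 0 σ := by
    ext p
    rw [mem_loop_diff_zero]
    have h4 := four_mul_loopHam p
    constructor
    · rintro ⟨hH, hs⟩
      have hd : wellDepth (p.1 + p.2) = (p.2 - p.1) ^ 2 := by linarith
      have hsσ : p.1 + p.2 ∈ Ioc 0 σ := ⟨hs, by
        by_contra hcon
        have := hneg _ (not_le.1 hcon)
        nlinarith [sq_nonneg (p.2 - p.1)]⟩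
      rcases le_total 0 (p.2 - p.1) with h | h
      · refine Or.inl ⟨p.1 + p.2, hsσ, ?_⟩
        simp only [br, hd, Real.sqrt_sq h]
        apply Prod.ext <;> simp <;> ring
      · refine Or.inr ⟨p.1 + p.2, hsσ, ?_⟩
        simp only [br, hd, Real.sqrt_sq_eq_abs, abs_of_nonpos h]
        apply Prod.ext <;> simp <;> ring
    · have hmem : ∀ e : ℝ, e ^ 2 = 1 → ∀ s ∈ Ioc 0 σ, br e s = p →
          loopHam p = 0 ∧ 0 < p.1 + p.2 := by
        rintro e he s hs rfl
        have e1 : (br e s).1 + (br e s).2 = s := by simp only [br]; ring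
        have e2 : ((br e s).2 - (br e s).1) ^ 2 = wellDepth s := by
          have : (br e s).2 - (br e s).1 = e * √(wellDepth s) := by simp only [br]; ring
          rw [this, mul_pow, Real.sq_sqrt (hnn s hs), he, one_mul]
        rw [e1, e2] at h4
        exact ⟨by linarith, by rw [e1]; exact hs.1⟩
      rintro (⟨s, hs, h⟩ | ⟨s, hs, h⟩)
      · exact hmem 1 (by norm_num) s hs h
      · exact hmem (-1) (by norm_num) s hs h
  rw [himg]
  have hσ : σ ∈ Ioc 0 σ := ⟨by linarith, le_rfl⟩
  refine IsConnected.union ⟨br 1 σ, ⟨σ, hσ, rfl⟩, σ, hσ, ?_⟩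
    ((isConnected_Ioc (by linarith)).image _ (hbr _).continuousOn)
    ((isConnected_Ioc (by linarith)).image _ (hbr _).continuousOn)
  simp [br, h0]

lemma zero_mem_closure_loop_diff : (0 : ℝ × ℝ) ∈ closure (loop \ {0}) := by
  have h : Tendsto (fun t : ℝ => ((0 : ℝ), t)) (𝓝[>] 0) (𝓝 (0, 0)) :=
    ((by fun_prop : Continuous fun t : ℝ => ((0 : ℝ), t)).tendsto 0).mono_left nhdsWithin_le_nhds
  refine mem_closure_of_tendsto h ?_
  filter_upwards [Ioo_mem_nhdsGT (show (0 : ℝ) < 1 by norm_num)] with t ht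
  rw [mem_loop_diff_zero]
  refine ⟨?_, by simpa using ht.1⟩
  rw [loopHam_of_le (by simp; linarith [ht.2])]
  simp

lemma isConnected_loop : IsConnected loop := by
  refine ⟨⟨0, zero_mem_loop⟩, isConnected_loop_diff.isPreconnected.subset_closure sdiff_subset ?_⟩
  intro p hp
  by_cases h : p = 0
  · rw [h]; exact zero_mem_closure_loop_diff
  · exact subset_closure ⟨hp, h⟩

/-- A critical point with s > 0 has d = 0 and s = 9/2, where U > 0, so it is not on the loop. -/
lemma isSmoothCurve_loop_diff : IsSmoothCurve (loop \ {0}) := by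
  have hcont : Continuous (fderiv ℝ loopHam) := contDiff_loopHam.continuous_fderiv (by simp)
  intro p hp
  have hp' := mem_loop_diff_zero.1 hp
  refine ⟨{q | 0 < q.1 + q.2} ∩ {q | fderiv ℝ loopHam q ≠ 0}, loopHam,
    (isOpen_lt continuous_const (continuous_fst.add continuous_snd)).inter (isOpen_ne_fun hcont continuous_const),
    ⟨hp'.2, fun h0 => ?_⟩, contDiff_loopHam.contDiffOn, fun q hq => hq.2, ?_⟩
  · rw [(hasFDerivAt_loopHam p).fderiv] at h0
    have e1 := DFunLike.congr_fun h0 (1, 0)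
    have e2 := DFunLike.congr_fun h0 (0, 1)
    simp at e1 e2
    have h4 := four_mul_loopHam p
    have hd : p.2 - p.1 = 0 := by linarith
    rw [hp'.1, hd] at h4
    rcases lt_trichotomy (p.1 + p.2) (9 / 2) with h | h | h
    · linarith [two_mul_turnForce_lt hp'.2 h]
    · linarith [wellDepth_pos hp'.2 h.le]
    · linarith [lt_two_mul_turnForce h]
  · ext q
    constructor
    · rintro ⟨hq, hU⟩
      exact ⟨hU, (mem_loop_diff_zero.1 hq).1⟩
    · rintro ⟨hU, hq⟩
      exact ⟨mem_loop_diff_zero.2 ⟨hq, hU.1⟩, hU⟩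

/-- The elliptic equilibrium inside the loop. -/
noncomputable def loopCenter : ℝ × ℝ := (9 / 4, 9 / 4)

/-- The Hamiltonian decreases along the rays issued from the centre. -/
lemma loopHam_lt_of_ray {p : ℝ × ℝ} (hp : p ≠ loopCenter) (hs : 0 ≤ p.1 + p.2) {r : ℝ}
    (h0 : 0 ≤ r) (h1 : r < 1) :
    loopHam p < loopHam (loopCenter + r • (p - loopCenter)) := by
  have e1 := four_mul_loopHam p
  have e2 := four_mul_loopHam (loopCenter + r • (p - loopCenter))
  have es : (loopCenter + r • (p - loopCenter)).1 + (loopCenter + r • (p - loopCenter)).2 =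
      9 / 2 + r * (p.1 + p.2 - 9 / 2) := by simp [loopCenter]; ring
  have ed : (loopCenter + r • (p - loopCenter)).2 - (loopCenter + r • (p - loopCenter)).1 =
      r * (p.2 - p.1) := by simp [loopCenter]; ring
  rw [es, ed] at e2
  have hr2 : r ^ 2 < 1 := by nlinarith
  -- Moving towards the centre brings s closer to 9/2, the maximum of U on s ≥ 0, and shrinks d².
  have hU : p.1 + p.2 ≠ 9 / 2 →
      wellDepth (p.1 + p.2) < wellDepth (9 / 2 + r * (p.1 + p.2 - 9 / 2)) := fun hne => by
    rcases lt_or_gt_of_ne hne with h | h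
    · exact strictMonoOn_wellDepth ⟨hs, h.le⟩ ⟨by nlinarith, by nlinarith⟩ (by nlinarith)
    · exact strictAntiOn_wellDepth (show (9 / 2 : ℝ) ≤ _ by nlinarith) h.le (by nlinarith)
  by_cases hse : p.1 + p.2 = 9 / 2
  · have hd : p.2 - p.1 ≠ 0 := fun hd => hp (Prod.ext
      (by simp only [loopCenter]; linarith) (by simp only [loopCenter]; linarith))
    have hd2 : 0 < (p.2 - p.1) ^ 2 := by positivity
    rw [hse, sub_self, mul_zero, add_zero] at e2
    rw [hse] at e1
    nlinarith
  · have := hU hse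
    nlinarith [sq_nonneg (p.2 - p.1)]

lemma loopCenter_ne_of_mem_loop {p : ℝ × ℝ} (hp : p ∈ loop) : p ≠ loopCenter := by
  rintro rfl
  have h4 := four_mul_loopHam loopCenter
  have := wellDepth_pos (s := 9 / 2) (by norm_num) le_rfl
  rw [hp.1] at h4
  simp only [loopCenter] at h4
  norm_num at h4
  linarith

/-- The loop is star-shaped around the centre. -/
lemma eq_of_ray_of_mem_loop {p q : ℝ × ℝ} (hp : p ∈ loop) (hq : q ∈ loop) {r : ℝ} (hr : 0 ≤ r)
    (h : q - loopCenter = r • (p - loopCenter)) : q = p := by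
  have hq' : q = loopCenter + r • (p - loopCenter) := by rw [← h]; abel
  rcases lt_trichotomy r 1 with h1 | h1 | h1
  · have := loopHam_lt_of_ray (loopCenter_ne_of_mem_loop hp) hp.2 hr h1
    rw [← hq', hp.1, hq.1] at this
    exact absurd this (lt_irrefl _)
  · rw [hq', h1, one_smul]; abel
  · have hp' : p = loopCenter + r⁻¹ • (q - loopCenter) := by
      rw [h, smul_smul, inv_mul_cancel₀ (by positivity), one_smul]; abel
    have := loopHam_lt_of_ray (loopCenter_ne_of_mem_loop hq) hq.2 (inv_nonneg.2 hr)
      (inv_lt_one_of_one_lt₀ h1)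
    rw [← hp', hp.1, hq.1] at this
    exact absurd this (lt_irrefl _)

lemma isOpen_loopInterior : IsOpen loopInterior :=
  (isOpen_lt continuous_const continuous_loopHam).inter
    (isOpen_lt continuous_const (continuous_fst.add continuous_snd))

lemma loopInterior_subset_box : loopInterior ⊆ Icc (-8 : ℝ) 8 ×ˢ Icc (-8 : ℝ) 8 := fun _ hp =>
  mem_box_of_loopHam_nonneg hp.1.le hp.2.le

/-- An unbounded ray in the complement of the loop, issued from an exterior point. -/
lemma exists_exterior_ray {p : ℝ × ℝ} (hp : p ∉ loop) (hp' : p ∉ loopInterior) :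
    ∃ v : ℝ × ℝ, v ≠ 0 ∧ ∀ t : ℝ, 0 ≤ t → p + t • v ∉ loop := by
  rcases le_or_gt (p.1 + p.2) 0 with hs | hs
  · refine ⟨(-1, -1), by simp, fun t ht hmem => ?_⟩
    have h2 := hmem.2
    simp at h2
    have ht0 : t = 0 := by linarith
    rw [ht0, zero_smul, add_zero] at hmem
    exact hp hmem
  · have hneg : loopHam p < 0 := by
      rcases lt_trichotomy (loopHam p) 0 with h | h | h
      · exact h
      · exact absurd ⟨h, hs.le⟩ hp
      · exact absurd ⟨h, hs⟩ hp'
    have h4 := four_mul_loopHam p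
    -- This direction keeps s fixed and does not decrease |d|, so H stays negative.
    have key : ∀ e : ℝ, 0 ≤ e * (p.2 - p.1) → ∀ t : ℝ, 0 ≤ t → p + t • (-e, e) ∉ loop := by
      intro e he t ht hmem
      have h4' := four_mul_loopHam (p + t • (-e, e))
      rw [hmem.1] at h4'
      have e1 : (p + t • (-e, e)).1 + (p + t • (-e, e)).2 = p.1 + p.2 := by simp; ring
      have e2 : (p + t • (-e, e)).2 - (p + t • (-e, e)).1 = p.2 - p.1 + 2 * t * e := by
        simp; ring
      rw [e1, e2] at h4'
      nlinarith [mul_nonneg ht he, sq_nonneg (t * e)]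
    rcases le_total 0 (p.2 - p.1) with h | h
    · exact ⟨(-1, 1), by simp, key 1 (by linarith)⟩
    · exact ⟨(- -1, -1), by simp, key (-1) (by linarith)⟩

/-- Exterior points escape to infinity along a ray that misses the loop. The interior is bounded,
and it is separated from the rest of the complement by two disjoint open sets. -/
lemma boundedDomain_loop : boundedDomain loop = loopInterior := by
  ext p
  constructor
  · rintro ⟨hp, hb⟩
    by_contra hcon
    obtain ⟨v, hv, hray⟩ := exists_exterior_ray hp hcon
    have hsub : (fun t : ℝ => p + t • v) '' Ici 0 ⊆ connectedComponentIn loopᶜ p := by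
      refine IsPreconnected.subset_connectedComponentIn
        (isPreconnected_Ici.image _ (by fun_prop)) ⟨0, by simp, by simp⟩ ?_
      rintro _ ⟨t, ht, rfl⟩
      exact hray t ht
    obtain ⟨R, hR⟩ := (hb.subset hsub).exists_norm_le
    have hvn := norm_pos_iff.2 hv
    have hnR : 0 ≤ R := (norm_nonneg _).trans (hR _ ⟨0, by simp, rfl⟩)
    have h1 := hR _ ⟨(R + ‖p‖ + 1) / ‖v‖, by rw [mem_Ici]; positivity, rfl⟩
    have h2 := norm_sub_le (p + ((R + ‖p‖ + 1) / ‖v‖) • v) p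
    rw [add_sub_cancel_left, norm_smul, Real.norm_of_nonneg (by positivity),
      div_mul_cancel₀ _ hvn.ne'] at h2
    simp only at h1
    linarith
  · intro hp
    have hpc : p ∈ loopᶜ := fun h => hp.1.ne' h.1
    refine ⟨hpc, ?_⟩
    have hsub : connectedComponentIn loopᶜ p ⊆ loopInterior := by
      refine isPreconnected_connectedComponentIn.subset_left_of_subset_union isOpen_loopInterior
        (v := {q | q.1 + q.2 < 0} ∪ {q | loopHam q < 0}) ?_ ?_ ?_
        ⟨p, mem_connectedComponentIn hpc, hp⟩
      · exact (isOpen_lt (continuous_fst.add continuous_snd) continuous_const).union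
          (isOpen_lt continuous_loopHam continuous_const)
      · rw [Set.disjoint_left]
        rintro q ⟨h1, h2⟩ (h | h)
        · exact absurd h2 (not_lt.2 (le_of_lt h))
        · exact absurd h1 (not_lt.2 (le_of_lt h))
      · intro q hq
        have hq' : q ∉ loop := connectedComponentIn_subset _ _ hq
        rcases lt_trichotomy (loopHam q) 0 with h | h | h
        · exact Or.inr (Or.inr h)
        · exact Or.inr (Or.inl (by
            by_contra hcon; exact hq' ⟨h, not_lt.1 hcon⟩))
        · rcases lt_trichotomy (q.1 + q.2) 0 with h' | h' | h'
          · exact Or.inr (Or.inl h')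
          · have := eq_zero_of_mem_loop h.le h'
            rw [this, loopHam_zero] at h
            exact absurd h (lt_irrefl _)
          · exact Or.inl ⟨h, h'⟩
    exact ((isCompact_Icc.prod isCompact_Icc).isBounded.subset loopInterior_subset_box).subset hsub

lemma exists_lipschitzWith_hamVectorField_loopHam :
    ∃ c, LipschitzWith c (hamVectorField loopHam) := by
  obtain ⟨c, hc⟩ := exists_lipschitzWith_turnForce
  have hs : LipschitzWith (c * (1 + 1)) (fun p : ℝ × ℝ => turnForce (p.1 + p.2)) :=
    hc.comp (LipschitzWith.prod_fst.add LipschitzWith.prod_snd)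
  have heq : hamVectorField loopHam =
      fun p => (turnForce (p.1 + p.2) - p.1, p.2 - turnForce (p.1 + p.2)) :=
    funext hamVectorField_loopHam
  rw [heq]
  exact ⟨_, (hs.sub LipschitzWith.prod_fst).prodMk (LipschitzWith.prod_snd.sub hs)⟩

end Hamiltonian

/-! ### Hamiltonian flows: conservation of area and energy -/

section HamiltonianFlow

/-- The symplectic form as a continuous bilinear map. -/
noncomputable def omegaBilin : (ℝ × ℝ) →L[ℝ] (ℝ × ℝ) →L[ℝ] ℝ :=
  (ContinuousLinearMap.mul ℝ ℝ).bilinearComp (ContinuousLinearMap.fst ℝ ℝ ℝ)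
      (ContinuousLinearMap.snd ℝ ℝ ℝ) -
    (ContinuousLinearMap.mul ℝ ℝ).bilinearComp (ContinuousLinearMap.snd ℝ ℝ ℝ)
      (ContinuousLinearMap.fst ℝ ℝ ℝ)

lemma omegaBilin_apply (u v : ℝ × ℝ) : omegaBilin u v = omega u v := rfl

/-- `Φ` is the smooth complete flow of the Hamiltonian `H`. -/
structure IsHamFlow (H : ℝ × ℝ → ℝ) (Φ : ℝ → ℝ × ℝ → ℝ × ℝ) : Prop where
  contDiff_ham : ContDiff ℝ ∞ H
  lipschitz : ∃ c, LipschitzWith c (hamVectorField H)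
  zero : ∀ p, Φ 0 p = p
  hasDerivAt : ∀ t p, HasDerivAt (fun s => Φ s p) (hamVectorField H (Φ t p)) t
  add : ∀ s t p, Φ (s + t) p = Φ s (Φ t p)
  contDiff : ∀ t, ContDiff ℝ ∞ (Φ t)
  omega : ∀ t p u v, omega (fderiv ℝ (Φ t) p u) (fderiv ℝ (Φ t) p v) = omega u v

lemma contDiff_hamVectorField {H : ℝ × ℝ → ℝ} (hH : ContDiff ℝ ∞ H) :
    ContDiff ℝ ∞ (hamVectorField H) := by
  have h := (contDiff_infty_iff_fderiv.1 hH).2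
  exact (h.clm_apply contDiff_const).neg.prodMk (h.clm_apply contDiff_const)

/-- The linearised field is J times the Hessian, and symmetry of the Hessian makes it
infinitesimally symplectic. -/
lemma omega_fderiv_hamVectorField {H : ℝ × ℝ → ℝ} (hH : ContDiff ℝ ∞ H) (p u v : ℝ × ℝ) :
    omegaBilin (fderiv ℝ (hamVectorField H) p u) v
      + omegaBilin u (fderiv ℝ (hamVectorField H) p v) = 0 := by
  have hd : HasFDerivAt (fderiv ℝ H) (fderiv ℝ (fderiv ℝ H) p) p :=
    ((contDiff_infty_iff_fderiv.1 hH).2.differentiable (by simp) p).hasFDerivAt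
  have hsymm : ∀ u v, fderiv ℝ (fderiv ℝ H) p u v = fderiv ℝ (fderiv ℝ H) p v u :=
    second_derivative_symmetric (fun q => (hH.differentiable (by simp) q).hasFDerivAt) hd
  have hX : HasFDerivAt (hamVectorField H) _ p :=
    (hd.clm_apply (hasFDerivAt_const ((0, 1) : ℝ × ℝ) p)).neg.prodMk
      (hd.clm_apply (hasFDerivAt_const ((1, 0) : ℝ × ℝ) p))
  have hdec : ∀ u v : ℝ × ℝ, fderiv ℝ (fderiv ℝ H) p u v =
      v.1 * fderiv ℝ (fderiv ℝ H) p u (1, 0) + v.2 * fderiv ℝ (fderiv ℝ H) p u (0, 1) := by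
    intro u v
    have : v = v.1 • ((1, 0) : ℝ × ℝ) + v.2 • ((0, 1) : ℝ × ℝ) := by ext <;> simp
    conv_lhs => rw [this, map_add, map_smul, map_smul]
    rfl
  have h1 := hdec u v
  have h2 := hdec v u
  rw [hsymm] at h1
  rw [hX.fderiv, omegaBilin_apply, omegaBilin_apply]
  simp [omega]
  linarith

theorem exists_isHamFlow {H : ℝ × ℝ → ℝ} (hH : ContDiff ℝ ∞ H)
    (hL : ∃ c, LipschitzWith c (hamVectorField H)) : ∃ Φ, IsHamFlow H Φ := by
  obtain ⟨c, hc⟩ := hL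
  obtain ⟨Φ, h0, hd, ha, hs, hB⟩ := exists_flow_of_lipschitz hc (contDiff_hamVectorField hH)
  exact ⟨Φ, hH, ⟨c, hc⟩, h0, hd, ha, hs, hB omegaBilin (omega_fderiv_hamVectorField hH)⟩

namespace IsHamFlow

variable {H : ℝ × ℝ → ℝ} {Φ : ℝ → ℝ × ℝ → ℝ × ℝ} (h : IsHamFlow H Φ)
include h

lemma neg_apply (t : ℝ) (p : ℝ × ℝ) : Φ (-t) (Φ t p) = p := by
  rw [← h.add, neg_add_cancel, h.zero]

lemma apply_neg (t : ℝ) (p : ℝ × ℝ) : Φ t (Φ (-t) p) = p := by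
  rw [← h.add, add_neg_cancel, h.zero]

lemma continuous (t : ℝ) : Continuous (Φ t) := (h.contDiff t).continuous

lemma ham_apply (t : ℝ) (p : ℝ × ℝ) : H (Φ t p) = H p := by
  have hd : ∀ s, HasDerivAt (fun s => H (Φ s p)) 0 s := fun s => by
    refine ((h.contDiff_ham.differentiable (by simp) (Φ s p)).hasFDerivAt.comp_hasDerivAt s
      (h.hasDerivAt s p)).congr_deriv ?_
    have : hamVectorField H (Φ s p) = (-(fderiv ℝ H (Φ s p) (0, 1))) • ((1, 0) : ℝ × ℝ)
        + (fderiv ℝ H (Φ s p) (1, 0)) • ((0, 1) : ℝ × ℝ) := by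
      ext <;> simp [hamVectorField]
    rw [this, map_add, map_smul, map_smul, smul_eq_mul, smul_eq_mul]
    ring
  have := is_const_of_deriv_eq_zero (fun s => (hd s).differentiableAt)
    (fun s => (hd s).deriv) t 0
  simpa [h.zero] using this

/-- A solution on an interval is given by the flow. -/
lemma eq_of_hasDerivAt {γ : ℝ → ℝ × ℝ} {t : ℝ}
    (hγ : ∀ τ ∈ uIcc 0 t, HasDerivAt γ (hamVectorField H (γ τ)) τ) : Φ t (γ 0) = γ t := by
  obtain ⟨c, hc⟩ := h.lipschitz
  have key : ∀ (γ : ℝ → ℝ × ℝ) (t : ℝ), 0 ≤ t →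
      (∀ τ ∈ Icc 0 t, HasDerivAt γ (hamVectorField H (γ τ)) τ) → Φ t (γ 0) = γ t := by
    intro γ t ht hγ
    refine ODE_solution_unique (v := fun _ => hamVectorField H) (f := fun s => Φ s (γ 0))
      (g := γ) (a := 0) (b := t) (fun _ => hc)
      (fun s _ => (h.hasDerivAt s _).continuousAt.continuousWithinAt)
      (fun s _ => (h.hasDerivAt s _).hasDerivWithinAt)
      (fun s hs => (hγ s hs).continuousAt.continuousWithinAt)
      (fun s hs => (hγ s (Ico_subset_Icc_self hs)).hasDerivWithinAt) (h.zero _) ⟨ht, le_rfl⟩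
  rcases le_total 0 t with ht | ht
  · exact key γ t ht (by rwa [uIcc_of_le ht] at hγ)
  · rw [uIcc_of_ge ht] at hγ
    have := key (fun τ => γ (τ + t)) (-t) (by linarith)
      (fun τ hτ => (hγ (τ + t) ⟨by linarith [hτ.1], by linarith [hτ.2]⟩).comp_add_const τ t)
    simp only [zero_add, neg_add_cancel] at this
    rw [← this, h.apply_neg]

/-- The flow at time `t` as a permutation. -/
def perm (t : ℝ) : Equiv.Perm (ℝ × ℝ) where
  toFun := Φ t
  invFun := Φ (-t)
  left_inv := h.neg_apply t
  right_inv := h.apply_neg t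

@[simp] lemma perm_apply (t : ℝ) (p : ℝ × ℝ) : h.perm t p = Φ t p := rfl

@[simp] lemma perm_symm_apply (t : ℝ) (p : ℝ × ℝ) : (h.perm t).symm p = Φ (-t) p := rfl

lemma perm_one_zpow_apply (n : ℤ) (p : ℝ × ℝ) : ((h.perm 1) ^ n) p = Φ n p := by
  induction n generalizing p with
  | zero => simp [h.zero]
  | succ n ih =>
    rw [zpow_add_one, Equiv.Perm.mul_apply, ih, perm_apply, ← h.add]
    push_cast; rfl
  | pred n ih =>
    rw [zpow_sub_one, Equiv.Perm.mul_apply, ih, Equiv.Perm.inv_def, perm_symm_apply, ← h.add]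
    push_cast; rfl

lemma isSymplecticDiffeo_perm (t : ℝ) : IsSymplecticDiffeo (h.perm t) :=
  ⟨h.contDiff t, h.contDiff (-t), h.omega t⟩

lemma isTimeOneMap : IsTimeOneMap H (h.perm 1) :=
  ⟨Φ, h.zero, h.hasDerivAt, fun _ => rfl⟩

end IsHamFlow

lemma IsSymplecticDiffeo.mul {f g : Equiv.Perm (ℝ × ℝ)} (hf : IsSymplecticDiffeo f)
    (hg : IsSymplecticDiffeo g) : IsSymplecticDiffeo (f * g) where
  contDiff := hf.contDiff.comp hg.contDiff
  contDiff_symm := hg.contDiff_symm.comp hf.contDiff_symm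
  symplectic p u v := by
    have : fderiv ℝ (fun q => (f * g) q) p =
        (fderiv ℝ (fun q => f q) (g p)).comp (fderiv ℝ (fun q => g q) p) :=
      fderiv_comp p (hf.contDiff.differentiable (by simp) _) (hg.contDiff.differentiable (by simp) _)
    rw [this, ContinuousLinearMap.comp_apply, ContinuousLinearMap.comp_apply, hf.symplectic,
      hg.symplectic]

end HamiltonianFlow

/-! ### Dynamics of the unperturbed flow on the loop -/

section LoopFlow

lemma axis_mem_loop_diff : ((0, 1) : ℝ × ℝ) ∈ loop \ {0} ∧ ((1, 0) : ℝ × ℝ) ∈ loop \ {0} := by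
  constructor <;> rw [mem_loop_diff_zero, loopHam_of_le (by norm_num)] <;> norm_num

variable {Φ : ℝ → ℝ × ℝ → ℝ × ℝ} (h : IsHamFlow loopHam Φ)
include h

lemma IsHamFlow.eq_linear_of_forall {p : ℝ × ℝ} {t : ℝ}
    (hp : ∀ τ ∈ uIcc 0 t, Real.exp (-τ) * p.1 + Real.exp τ * p.2 ≤ 4) :
    Φ t p = (Real.exp (-t) * p.1, Real.exp t * p.2) := by
  have := h.eq_of_hasDerivAt (γ := fun τ => (Real.exp (-τ) * p.1, Real.exp τ * p.2)) (t := t)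
    (fun τ hτ => by
      have h1 : HasDerivAt (fun τ => Real.exp (-τ) * p.1) (-(Real.exp (-τ) * p.1)) τ :=
        ((hasDerivAt_neg τ).exp.mul_const p.1).congr_deriv (by ring)
      have h2 : HasDerivAt (fun τ => Real.exp τ * p.2) (Real.exp τ * p.2) τ :=
        (Real.hasDerivAt_exp τ).mul_const p.2
      refine (h1.prodMk h2).congr_deriv ?_
      rw [hamVectorField_loopHam, turnForce_of_le (hp τ hτ), zero_sub, sub_zero])
  simpa using this

/-- In the positive quadrant x + y is convex in time along the linear flow, so it suffices to bound
it at both ends. -/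
lemma IsHamFlow.eq_linear {p : ℝ × ℝ} {t : ℝ} (h1 : 0 ≤ p.1) (h2 : 0 ≤ p.2) (h3 : p.1 + p.2 ≤ 4)
    (h4 : Real.exp (-t) * p.1 + Real.exp t * p.2 ≤ 4) :
    Φ t p = (Real.exp (-t) * p.1, Real.exp t * p.2) := by
  refine h.eq_linear_of_forall fun τ hτ => ?_
  have hconv : ConvexOn ℝ univ (fun τ => Real.exp (-τ) * p.1 + Real.exp τ * p.2) := by
    have e1 := (convexOn_exp.comp_linearMap (-LinearMap.id : ℝ →ₗ[ℝ] ℝ)).smul h1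
    have e2 := (convexOn_exp.smul h2)
    refine (e1.add e2).congr fun τ _ => ?_
    simp [mul_comm]
  refine (hconv.le_max_of_mem_segment (mem_univ 0) (mem_univ t)
    (by rwa [segment_eq_uIcc])).trans (max_le (by simpa using h3) h4)

lemma IsHamFlow.eventually_eq_linear :
    ∀ᶠ p in 𝓝 (0 : ℝ × ℝ), Φ 1 p = (Real.exp (-1) * p.1, Real.exp 1 * p.2) := by
  filter_upwards [Metric.ball_mem_nhds (0 : ℝ × ℝ) (show (0 : ℝ) < 1 / 2 by norm_num)] with p hp
  rw [mem_ball_zero_iff, Prod.norm_def, max_lt_iff, Real.norm_eq_abs, Real.norm_eq_abs, abs_lt,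
    abs_lt] at hp
  refine h.eq_linear_of_forall fun τ hτ => ?_
  rw [uIcc_of_le zero_le_one] at hτ
  have h1 : Real.exp (-τ) ≤ 1 := Real.exp_le_one_iff.2 (by linarith [hτ.1])
  have h2 : Real.exp τ ≤ 3 := (Real.exp_le_exp.2 hτ.2).trans (by linarith [Real.exp_one_lt_d9])
  have h3 := Real.exp_pos (-τ)
  have h4 := Real.exp_pos τ
  nlinarith

lemma IsHamFlow.hasDerivAt_sum (t : ℝ) (p : ℝ × ℝ) :
    HasDerivAt (fun s => (Φ s p).1 + (Φ s p).2) ((Φ t p).2 - (Φ t p).1) t := by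
  have hd := h.hasDerivAt t p
  rw [hamVectorField_loopHam] at hd
  have h1 := (ContinuousLinearMap.fst ℝ ℝ ℝ).hasFDerivAt.comp_hasDerivAt t hd
  have h2 := (ContinuousLinearMap.snd ℝ ℝ ℝ).hasFDerivAt.comp_hasDerivAt t hd
  refine (h1.add h2).congr_deriv ?_
  simp

lemma IsHamFlow.hasDerivAt_diff (t : ℝ) (p : ℝ × ℝ) :
    HasDerivAt (fun s => (Φ s p).2 - (Φ s p).1)
      ((Φ t p).1 + (Φ t p).2 - 2 * turnForce ((Φ t p).1 + (Φ t p).2)) t := by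
  have hd := h.hasDerivAt t p
  rw [hamVectorField_loopHam] at hd
  have h1 := (ContinuousLinearMap.fst ℝ ℝ ℝ).hasFDerivAt.comp_hasDerivAt t hd
  have h2 := (ContinuousLinearMap.snd ℝ ℝ ℝ).hasFDerivAt.comp_hasDerivAt t hd
  refine (h2.sub h1).congr_deriv ?_
  simp; ring

lemma IsHamFlow.continuous_curve (p : ℝ × ℝ) : Continuous fun t => Φ t p :=
  continuous_iff_continuousAt.2 fun t => (h.hasDerivAt t p).continuousAt

/-- Near `p` one coordinate determines a point of the loop: s when d ≠ 0 (the sign of d being kept),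
and d at the turning point (U being injective past 9/2). That coordinate has nonzero speed along the
flow, so the orbit takes all its nearby values. -/
lemma IsHamFlow.eventually_mem_orbit {p : ℝ × ℝ} (hp : p ∈ loop \ {0}) :
    ∀ᶠ q in 𝓝[loop \ {0}] p, ∃ t, q = Φ t p := by
  have hc := h.continuous_curve p
  have hp' := mem_loop_diff_zero.1 hp
  have hcs : Continuous fun q : ℝ × ℝ => q.1 + q.2 := by fun_prop
  have hcd : Continuous fun q : ℝ × ℝ => q.2 - q.1 := by fun_prop
  have hU : ∀ {q : ℝ × ℝ}, loopHam q = 0 → wellDepth (q.1 + q.2) = (q.2 - q.1) ^ 2 :=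
    fun {q} hq => by have := four_mul_loopHam q; linarith
  have hext : ∀ {q r : ℝ × ℝ}, q.1 + q.2 = r.1 + r.2 → q.2 - q.1 = r.2 - r.1 → q = r :=
    fun h1 h2 => Prod.ext (by linarith) (by linarith)
  by_cases hd : p.2 - p.1 = 0
  · have hs : 9 / 2 < p.1 + p.2 := by
      by_contra hcon
      have h1 := wellDepth_pos hp'.2 (not_lt.1 hcon)
      rw [hU hp'.1, hd] at h1
      norm_num at h1
    have hstrict : HasStrictDerivAt (fun t => (Φ t p).2 - (Φ t p).1) _ 0 :=
      hasStrictDerivAt_of_hasDerivAt_of_continuousAt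
        (Eventually.of_forall fun t => h.hasDerivAt_diff t p)
        (Continuous.continuousAt (by have := continuous_turnForce; fun_prop))
    have hmap := hstrict.map_nhds_eq (by rw [h.zero]; linarith [lt_two_mul_turnForce hs])
    have hT : ∀ᶠ t in 𝓝 (0 : ℝ), 9 / 2 < (Φ t p).1 + (Φ t p).2 :=
      (hcs.comp hc).continuousAt.eventually_const_lt (by simpa [h.zero] using hs)
    have hI : (fun t => (Φ t p).2 - (Φ t p).1) '' {t | 9 / 2 < (Φ t p).1 + (Φ t p).2} ∈
        𝓝 (p.2 - p.1) := by
      have := image_mem_map (m := fun t => (Φ t p).2 - (Φ t p).1) hT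
      rwa [hmap, h.zero] at this
    filter_upwards [self_mem_nhdsWithin, mem_nhdsWithin_of_mem_nhds (hcd.continuousAt hI),
      mem_nhdsWithin_of_mem_nhds (hcs.continuousAt.eventually_const_lt hs)] with q hq hqd hqs
    obtain ⟨t, ht, htd⟩ := hqd
    refine ⟨t, hext ?_ htd.symm⟩
    refine strictAntiOn_wellDepth.injOn (mem_Ici.2 (le_of_lt hqs)) (mem_Ici.2 (le_of_lt ht)) ?_
    have := h.ham_apply t p
    rw [hp'.1] at this
    rw [hU (mem_loop_diff_zero.1 hq).1, hU this, ← show (Φ t p).2 - (Φ t p).1 = q.2 - q.1 from htd]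
  · have hstrict : HasStrictDerivAt (fun t => (Φ t p).1 + (Φ t p).2) _ 0 :=
      hasStrictDerivAt_of_hasDerivAt_of_continuousAt
        (Eventually.of_forall fun t => h.hasDerivAt_sum t p)
        (Continuous.continuousAt (by fun_prop))
    have hmap := hstrict.map_nhds_eq (by rwa [h.zero])
    have hdd : 0 < (p.2 - p.1) * (p.2 - p.1) := mul_self_pos.2 hd
    have hT : ∀ᶠ t in 𝓝 (0 : ℝ), 0 < ((Φ t p).2 - (Φ t p).1) * (p.2 - p.1) :=
      ((hcd.comp hc).mul continuous_const).continuousAt.eventually_const_lt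
        (by simpa [h.zero] using hdd)
    have hI : (fun t => (Φ t p).1 + (Φ t p).2) ''
        {t | 0 < ((Φ t p).2 - (Φ t p).1) * (p.2 - p.1)} ∈ 𝓝 (p.1 + p.2) := by
      have := image_mem_map (m := fun t => (Φ t p).1 + (Φ t p).2) hT
      rwa [hmap, h.zero] at this
    filter_upwards [self_mem_nhdsWithin, mem_nhdsWithin_of_mem_nhds (hcs.continuousAt hI),
      mem_nhdsWithin_of_mem_nhds ((hcd.mul continuous_const).continuousAt.eventually_const_lt hdd)]
      with q hq hqs hqd
    obtain ⟨t, ht, hts⟩ := hqs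
    refine ⟨t, hext hts.symm ?_⟩
    have h1 := h.ham_apply t p
    rw [hp'.1] at h1
    have h2 := hU h1
    have h3 := hU (mem_loop_diff_zero.1 hq).1
    simp only [mem_ofPred_eq] at ht hts
    replace hqd : 0 < (q.2 - q.1) * (p.2 - p.1) := hqd
    rw [hts] at h2
    rcases sq_eq_sq_iff_eq_or_eq_neg.1 (h3.symm.trans h2) with h4 | h4
    · exact h4
    · rw [h4] at hqd
      nlinarith

/-- The loop without the origin is a single orbit. -/
lemma IsHamFlow.exists_eq_of_mem_loop {p q : ℝ × ℝ} (hp : p ∈ loop \ {0}) (hq : q ∈ loop \ {0}) :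
    ∃ t, q = Φ t p := by
  refine isConnected_loop_diff.isPreconnected.induction₂ (fun p q => ∃ t, q = Φ t p)
    (fun p hp => h.eventually_mem_orbit hp) ?_ ?_ hp hq
  · rintro x y z - - - ⟨s, rfl⟩ ⟨t, rfl⟩
    exact ⟨t + s, (h.add _ _ _).symm⟩
  · rintro x y - - ⟨t, rfl⟩
    exact ⟨-t, (h.neg_apply _ _).symm⟩

lemma IsHamFlow.apply_zero (t : ℝ) : Φ t 0 = 0 := by
  rw [h.eq_linear (p := 0) (t := t) (by simp) (by simp) (by simp) (by simp)]
  simp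

lemma IsHamFlow.apply_unstable {t : ℝ} (ht : t ≤ 1) : Φ t (0, 1) = (0, Real.exp t) := by
  have h1 : Real.exp t ≤ 4 := (Real.exp_le_exp.2 ht).trans (by linarith [Real.exp_one_lt_d9])
  simpa using h.eq_linear (p := (0, 1)) (t := t) (by simp) (by simp) (by norm_num) (by simpa)

lemma IsHamFlow.apply_stable {t : ℝ} (ht : 0 ≤ t) : Φ t (1, 0) = (Real.exp (-t), 0) := by
  have h1 : Real.exp (-t) ≤ 4 := (Real.exp_le_one_iff.2 (by linarith)).trans (by norm_num)
  simpa using h.eq_linear (p := (1, 0)) (t := t) (by simp) (by simp) (by norm_num) (by simpa)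

lemma IsHamFlow.tendsto_atTop {p : ℝ × ℝ} (hp : p ∈ loop) : Tendsto (fun t => Φ t p) atTop (𝓝 0) := by
  by_cases hp0 : p = 0
  · simp [hp0, h.apply_zero]
  obtain ⟨t₀, ht₀⟩ := h.exists_eq_of_mem_loop axis_mem_loop_diff.2 ⟨hp, hp0⟩
  have h1 : Tendsto (fun t => (Real.exp (-(t + t₀)), (0 : ℝ))) atTop (𝓝 (0, 0)) :=
    (Real.tendsto_exp_neg_atTop_nhds_zero.comp (tendsto_atTop_add_const_right _ t₀ tendsto_id)).prodMk_nhds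
      tendsto_const_nhds
  refine h1.congr' ?_
  filter_upwards [eventually_ge_atTop (-t₀)] with t ht
  rw [ht₀, ← h.add, h.apply_stable (by linarith)]

lemma IsHamFlow.tendsto_atBot {p : ℝ × ℝ} (hp : p ∈ loop) : Tendsto (fun t => Φ t p) atBot (𝓝 0) := by
  by_cases hp0 : p = 0
  · simp [hp0, h.apply_zero]
  obtain ⟨t₀, ht₀⟩ := h.exists_eq_of_mem_loop axis_mem_loop_diff.1 ⟨hp, hp0⟩
  have h1 : Tendsto (fun t => ((0 : ℝ), Real.exp (t + t₀))) atBot (𝓝 (0, 0)) :=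
    tendsto_const_nhds.prodMk_nhds
      (Real.tendsto_exp_atBot.comp (tendsto_atBot_add_const_right _ t₀ tendsto_id))
  refine h1.congr' ?_
  filter_upwards [eventually_le_atBot (1 - t₀)] with t ht
  rw [ht₀, ← h.add, h.apply_unstable (by linarith)]

/-- An orbit of zero energy could leave only across s = 0, where the sole such point is the
equilibrium 0. -/
lemma IsHamFlow.apply_mem_loop {p : ℝ × ℝ} (hp : p ∈ loop) (t : ℝ) : Φ t p ∈ loop := by
  refine ⟨by rw [h.ham_apply, hp.1], ?_⟩
  by_contra hcon
  obtain ⟨τ, hτ⟩ : ∃ τ, (Φ τ p).1 + (Φ τ p).2 = 0 := by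
    have hc := h.continuous_curve p
    have := mem_range_of_exists_le_of_exists_ge (f := fun τ => (Φ τ p).1 + (Φ τ p).2) (c := 0)
      (by fun_prop) ⟨t, (not_le.1 hcon).le⟩ ⟨0, by rw [h.zero]; exact hp.2⟩
    exact this
  have h0 : Φ τ p = 0 := eq_zero_of_mem_loop (by rw [h.ham_apply, hp.1]) hτ
  have : p = 0 := by rw [← h.neg_apply τ p, h0, h.apply_zero]
  rw [this, h.apply_zero] at hcon
  simp at hcon

lemma IsHamFlow.image_loop (t : ℝ) : h.perm t '' loop = loop := by
  refine Subset.antisymm (image_subset_iff.2 fun p hp => h.apply_mem_loop hp t) fun p hp => ?_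
  exact ⟨Φ (-t) p, h.apply_mem_loop hp _, h.apply_neg t p⟩

/-- The flow on the loop has no periodic orbits besides the origin. -/
lemma IsHamFlow.time_injective {p : ℝ × ℝ} (hp : p ∈ loop \ {0}) {s t : ℝ} (hst : Φ s p = Φ t p) :
    s = t := by
  by_contra hne
  have hT : s - t ≠ 0 := sub_ne_zero.2 hne
  have hper : Φ (s - t) p = p := by
    rw [show s - t = -t + s by ring, h.add, hst, h.neg_apply]
  have hn : ∀ n : ℕ, Φ (n * |s - t|) p = p := by
    have habs : Φ |s - t| p = p := by
      rcases abs_choice (s - t) with h1 | h1 <;> rw [h1]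
      · exact hper
      · conv_lhs => rw [← hper]
        rw [h.neg_apply]
    intro n
    induction n with
    | zero => simp [h.zero]
    | succ n ih =>
      push_cast
      rw [add_mul, one_mul, h.add, habs, ih]
  have h1 : Tendsto (fun n : ℕ => Φ (n * |s - t|) p) atTop (𝓝 0) :=
    (h.tendsto_atTop hp.1).comp (tendsto_natCast_atTop_atTop.atTop_mul_const (abs_pos.2 hT))
  simp_rw [hn] at h1
  exact hp.2 (tendsto_nhds_unique tendsto_const_nhds h1)

end LoopFlow

lemma isHyperbolicFixedPt_of_eventually {f : Equiv.Perm (ℝ × ℝ)}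
    (hf : ∀ᶠ p in 𝓝 (0 : ℝ × ℝ), f p = (Real.exp (-1) * p.1, Real.exp 1 * p.2)) :
    IsHyperbolicFixedPt f := by
  let A : ℝ × ℝ →L[ℝ] ℝ × ℝ :=
    (Real.exp (-1) • ContinuousLinearMap.fst ℝ ℝ ℝ).prod
      (Real.exp 1 • ContinuousLinearMap.snd ℝ ℝ ℝ)
  have hd : HasFDerivAt (fun p => f p) A 0 := A.hasFDerivAt.congr_of_eventuallyEq hf
  refine ⟨by rw [hf.self_of_nhds]; simp, hd.differentiableAt, Real.exp (-1), Real.exp 1, ?_, ?_, ?_⟩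
  · rw [Ne, Real.exp_eq_exp]; norm_num
  · rw [hd.fderiv]
    refine Module.End.hasEigenvalue_of_hasEigenvector (x := ((1, 0) : ℝ × ℝ)) ⟨?_, by simp⟩
    rw [Module.End.mem_eigenspace_iff]
    simp [A]
  · rw [hd.fderiv]
    refine Module.End.hasEigenvalue_of_hasEigenvector (x := ((0, 1) : ℝ × ℝ)) ⟨?_, by simp⟩
    rw [Module.End.mem_eigenspace_iff]
    simp [A]

lemma IsHamFlow.isSeparatrix_loop {Φ : ℝ → ℝ × ℝ → ℝ × ℝ} (h : IsHamFlow loopHam Φ) :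
    IsSeparatrix (h.perm 1) loop where
  hyperbolic := isHyperbolicFixedPt_of_eventually h.eventually_eq_linear
  isCompact := isCompact_loop
  isConnected := isConnected_loop
  zero_mem := zero_mem_loop
  invariant := h.image_loop 1
  isConnected_diff := isConnected_loop_diff
  isSmoothCurve_diff := isSmoothCurve_loop_diff
  tendsto_forward p hp := by
    simp_rw [h.perm_one_zpow_apply]
    exact (h.tendsto_atTop hp).comp tendsto_intCast_atTop_atTop
  tendsto_backward p hp := by
    simp_rw [h.perm_one_zpow_apply]
    exact (h.tendsto_atBot hp).comp (tendsto_intCast_atBot_iff.2 tendsto_id)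

/-! ### The Hamiltonian of the kick -/

section Kick

/-- A cutoff in the transverse direction. -/
noncomputable def transverseBump : ContDiffBump (0 : ℝ) := ⟨1 / 2, 1, by norm_num, by norm_num⟩

/-- A cutoff along the unstable axis. -/
noncomputable def axialBump : ContDiffBump (1 : ℝ) := ⟨1 / 10, 1 / 5, by norm_num, by norm_num⟩

/-- The velocity of the kick along the unstable axis. -/
noncomputable def kickSpeed (y : ℝ) : ℝ := axialBump y * (y * Real.log y)

/-- The Hamiltonian of the perturbation. -/
noncomputable def kickHam (p : ℝ × ℝ) : ℝ := p.1 * transverseBump p.1 * kickSpeed p.2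

/-- A box that contains the support of the perturbation. -/
def kickBox : Set (ℝ × ℝ) := Icc (-1) 1 ×ˢ Icc (4 / 5) (6 / 5)

lemma kickSpeed_eq_zero {y : ℝ} (h : 1 / 5 ≤ |y - 1|) : kickSpeed y = 0 := by
  rw [kickSpeed, axialBump.zero_of_le_dist (by rwa [Real.dist_eq]), zero_mul]

lemma contDiff_kickSpeed : ContDiff ℝ ∞ kickSpeed := by
  rw [contDiff_iff_contDiffAt]
  intro y
  by_cases hy : y = 0
  · refine (contDiffAt_const (c := (0 : ℝ))).congr_of_eventuallyEq ?_
    filter_upwards [Iio_mem_nhds (show y < 1 / 2 by rw [hy]; norm_num)] with x hx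
    refine kickSpeed_eq_zero ?_
    rw [mem_Iio] at hx
    rw [abs_of_neg (by linarith)]
    linarith
  · exact axialBump.contDiffAt.mul (contDiffAt_id.mul (Real.contDiffAt_log.2 hy))

lemma contDiff_kickHam : ContDiff ℝ ∞ kickHam :=
  (contDiff_fst.mul (transverseBump.contDiff.comp contDiff_fst)).mul
    (contDiff_kickSpeed.comp contDiff_snd)

lemma isCompact_kickBox : IsCompact kickBox := isCompact_Icc.prod isCompact_Icc

lemma kickHam_eq_zero {p : ℝ × ℝ} (hp : p ∉ kickBox) : kickHam p = 0 := by
  rw [kickHam]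
  by_cases h1 : p.1 ∈ Icc (-1 : ℝ) 1
  · have h2 : p.2 ∉ Icc (4 / 5 : ℝ) (6 / 5) := fun h2 => hp ⟨h1, h2⟩
    rw [kickSpeed_eq_zero, mul_zero]
    by_contra hcon
    rw [not_le, abs_lt] at hcon
    exact h2 ⟨by linarith, by linarith⟩
  · rw [transverseBump.zero_of_le_dist, mul_zero, zero_mul]
    rw [Real.dist_eq, sub_zero]
    by_contra hcon
    exact h1 (abs_le.1 (not_le.1 hcon).le)

lemma hamVectorField_kickHam_eq_zero {p : ℝ × ℝ} (hp : p ∉ kickBox) :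
    hamVectorField kickHam p = 0 := by
  have : kickHam =ᶠ[𝓝 p] fun _ => 0 := by
    filter_upwards [isCompact_kickBox.isClosed.isOpen_compl.mem_nhds hp] with q hq
    exact kickHam_eq_zero hq
  rw [hamVectorField, this.fderiv_eq]
  simp

lemma exists_lipschitzWith_hamVectorField_kickHam :
    ∃ c, LipschitzWith c (hamVectorField kickHam) :=
  (contDiff_hamVectorField contDiff_kickHam).lipschitzWith_of_hasCompactSupport
    (HasCompactSupport.intro isCompact_kickBox fun _ hp => hamVectorField_kickHam_eq_zero hp)
    (by simp)

lemma hamVectorField_kickHam_axis (y : ℝ) : (hamVectorField kickHam (0, y)).1 = 0 := by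
  have h1 : HasDerivAt (fun t : ℝ => kickHam (0, t)) (fderiv ℝ kickHam (0, y) (0, 1)) y :=
    (contDiff_kickHam.differentiable (by simp) (0, y)).hasFDerivAt.comp_hasDerivAt y
      ((hasDerivAt_const y (0 : ℝ)).prodMk (hasDerivAt_id y))
  have h2 : (fun t : ℝ => kickHam (0, t)) = fun _ => 0 := by
    funext t; simp [kickHam]
  rw [h2] at h1
  rw [hamVectorField, h1.unique (hasDerivAt_const y 0), neg_zero]

/-- For this field (log y)' = log y and (xy)' = -xy: in unit time log y is multiplied by e and the
energy xy is divided by e. -/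
lemma hamVectorField_kickHam {p : ℝ × ℝ} (h1 : |p.1| < 1 / 2) (h2 : |p.2 - 1| < 1 / 10) :
    hamVectorField kickHam p = (-(p.1 * (Real.log p.2 + 1)), p.2 * Real.log p.2) := by
  have hev : kickHam =ᶠ[𝓝 p] fun q => q.1 * (q.2 * Real.log q.2) := by
    have e1 : ∀ᶠ q : ℝ × ℝ in 𝓝 p, |q.1| < 1 / 2 :=
      (by fun_prop : Continuous fun q : ℝ × ℝ => |q.1|).continuousAt.eventually_lt_const h1
    have e2 : ∀ᶠ q : ℝ × ℝ in 𝓝 p, |q.2 - 1| < 1 / 10 :=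
      (by fun_prop : Continuous fun q : ℝ × ℝ => |q.2 - 1|).continuousAt.eventually_lt_const h2
    filter_upwards [e1, e2] with q hq1 hq2
    rw [kickHam, kickSpeed, transverseBump.one_of_mem_closedBall, axialBump.one_of_mem_closedBall,
      mul_one, one_mul]
    · rw [Metric.mem_closedBall, Real.dist_eq]; exact hq2.le
    · rw [Metric.mem_closedBall, Real.dist_eq, sub_zero]; exact hq1.le
  have hp2 : p.2 ≠ 0 := by
    rw [abs_lt] at h2; linarith [h2.1]
  have hd : HasFDerivAt (fun q : ℝ × ℝ => q.1 * (q.2 * Real.log q.2))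
      (p.1 • ((Real.log p.2 + 1) • ContinuousLinearMap.snd ℝ ℝ ℝ) +
        (p.2 * Real.log p.2) • ContinuousLinearMap.fst ℝ ℝ ℝ) p :=
    (hasFDerivAt_fst (p := p)).mul
      ((Real.hasDerivAt_mul_log hp2).comp_hasFDerivAt p (hasFDerivAt_snd (p := p)))
  rw [hamVectorField, hev.fderiv_eq, hd.fderiv]
  simp

end Kick

lemma eq_zero_of_abs_deriv_le {x x' : ℝ → ℝ} {c : ℝ} (hx : ∀ t, HasDerivAt x (x' t) t)
    (hb : ∀ t, |x' t| ≤ c * |x t|) (h0 : x 0 = 0) (t : ℝ) : x t = 0 := by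
  have key : ∀ (x x' : ℝ → ℝ), (∀ t, HasDerivAt x (x' t) t) → (∀ t, |x' t| ≤ c * |x t|) →
      x 0 = 0 → ∀ t, 0 ≤ t → x t = 0 := fun x x' hx hb h0 t ht =>
    eq_zero_of_abs_deriv_le_mul_abs_self_of_eq_zero_right (f' := x') (K := c) (a := 0) (b := t)
      (fun s _ => (hx s).continuousAt.continuousWithinAt) (fun s _ => (hx s).hasDerivWithinAt) h0
      (fun s _ => hb s) t ⟨ht, le_rfl⟩
  rcases le_total 0 t with ht | ht
  · exact key x x' hx hb h0 t ht
  · have := key (fun s => x (-s)) (fun s => -x' (-s))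
      (fun s => ((hx (-s)).scomp s (hasDerivAt_neg s)).congr_deriv (by simp))
      (fun s => by rw [abs_neg]; exact hb (-s)) (by simpa using h0) (-t) (by linarith)
    simpa using this

/-! ### The time-one kick -/

section KickFlow

variable {Ψ : ℝ → ℝ × ℝ → ℝ × ℝ} (k : IsHamFlow kickHam Ψ)
include k

lemma IsHamFlow.kick_eq_self {p : ℝ × ℝ} (hp : p ∉ kickBox) (t : ℝ) : Ψ t p = p :=
  k.eq_of_hasDerivAt (γ := fun _ => p) fun τ _ => by
    rw [hamVectorField_kickHam_eq_zero hp]; exact hasDerivAt_const τ p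

lemma IsHamFlow.kick_mem_box {p : ℝ × ℝ} (hp : p ∈ kickBox) (t : ℝ) : Ψ t p ∈ kickBox := by
  by_contra hcon
  have h1 := k.kick_eq_self hcon (-t)
  rw [k.neg_apply] at h1
  exact hcon (h1 ▸ hp)

/-- The horizontal speed vanishes on the axis, so the Lipschitz bound gives |x'| ≤ c|x| and Grönwall
applies. -/
lemma IsHamFlow.kick_axis (t y : ℝ) : (Ψ t (0, y)).1 = 0 := by
  obtain ⟨c, hc⟩ := k.lipschitz
  refine eq_zero_of_abs_deriv_le (x := fun s => (Ψ s (0, y)).1)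
    (x' := fun s => (hamVectorField kickHam (Ψ s (0, y))).1) (c := c) (fun s => ?_) (fun s => ?_)
    (by simp [k.zero]) t
  · exact (ContinuousLinearMap.fst ℝ ℝ ℝ).hasFDerivAt.comp_hasDerivAt s (k.hasDerivAt s (0, y))
  · have h1 := hc.dist_le_mul (Ψ s (0, y)) (0, (Ψ s (0, y)).2)
    have h2 : dist (Ψ s (0, y)) (0, (Ψ s (0, y)).2) = |(Ψ s (0, y)).1| := by
      rw [Prod.dist_eq, dist_self, Real.dist_eq, sub_zero, max_eq_left (abs_nonneg _)]
    rw [h2, Prod.dist_eq] at h1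
    have h3 := (le_max_left _ _).trans h1
    rwa [hamVectorField_kickHam_axis, Real.dist_eq, sub_zero] at h3

/-- The explicit form of the kick near the point `(0, 1)`. -/
lemma IsHamFlow.kick_apply {t a : ℝ} (ht : |t| ≤ 1 / 60) (ha : |a| < 1 / 4) :
    Ψ 1 (a * Real.exp (-t), Real.exp t) =
      (a * Real.exp (-1) * Real.exp (-(Real.exp 1 * t)), Real.exp (Real.exp 1 * t)) := by
  have := k.eq_of_hasDerivAt (t := 1)
    (γ := fun τ => (a * Real.exp (-τ) * Real.exp (-(Real.exp τ * t)), Real.exp (Real.exp τ * t)))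
    (fun τ hτ => by
      rw [uIcc_of_le zero_le_one] at hτ
      have he : HasDerivAt (fun τ => Real.exp τ * t) (Real.exp τ * t) τ :=
        (Real.hasDerivAt_exp τ).mul_const t
      have hn : HasDerivAt (fun τ => Real.exp (-τ)) (-Real.exp (-τ)) τ :=
        (hasDerivAt_neg τ).exp.congr_deriv (by ring)
      have d1 := ((hn.const_mul a).mul he.neg.exp).prodMk he.exp
      refine d1.congr_deriv ?_
      have hτ3 : Real.exp τ ≤ 3 :=
        (Real.exp_le_exp.2 hτ.2).trans (by linarith [Real.exp_one_lt_d9])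
      have habs : |Real.exp τ * t| ≤ 1 / 20 := by
        rw [abs_mul, Real.abs_exp]
        nlinarith [abs_nonneg t, Real.exp_pos τ]
      -- As e ≤ 3, the bound 1/60 on |t| keeps the exponent within 1/20 and the curve where both
      -- cutoffs equal 1.
      have hb : ∀ x : ℝ, |x| ≤ 1 / 20 → |Real.exp x - 1| ≤ 1 / 10 - 1 / 1000 := fun x hx => by
        have h1 := Real.abs_exp_sub_one_sub_id_le (x := x) (by linarith)
        have h2 : x ^ 2 ≤ 1 / 400 := by rw [← sq_abs]; nlinarith [abs_nonneg x]
        have h3 := abs_add_le (Real.exp x - 1 - x) x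
        rw [sub_add_cancel] at h3
        linarith
      have hb1 := hb _ habs
      have hb2 := hb (-(Real.exp τ * t)) (by rwa [abs_neg])
      rw [hamVectorField_kickHam]
      · simp only [Real.log_exp]
        ext
        · simp; ring
        · simp
      · have h1 : Real.exp (-τ) ≤ 1 := Real.exp_le_one_iff.2 (by linarith [hτ.1])
        have h2 : Real.exp (-(Real.exp τ * t)) ≤ 2 := by
          rw [abs_le] at hb2; linarith [hb2.2]
        simp only [abs_mul, Real.abs_exp]
        calc |a| * Real.exp (-τ) * Real.exp (-(Real.exp τ * t)) ≤ |a| * 1 * 2 := by gcongr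
          _ < 1 / 2 := by linarith
      · change |Real.exp (Real.exp τ * t) - 1| < 1 / 10
        linarith)
  simpa using this

end KickFlow

/-! ### The perturbed map and its separatrix -/

section Perturbation

lemma mem_loop_inter_kickBox {p : ℝ × ℝ} (hp : p ∈ loop) (hb : p ∈ kickBox) :
    p.1 = 0 := by
  have h1 := hp.1
  rw [loopHam_of_le (by linarith [hb.1.2, hb.2.2])] at h1
  rcases mul_eq_zero.1 h1 with h2 | h2
  · exact h2
  · linarith [hb.2.1]

/-- The kick box covers less than one unit of time on the loop, so an orbit on the loop is kicked at
most once. -/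
lemma log_six_fifths_lt : Real.log (6 / 5) < Real.log (4 / 5) + 1 := by
  have h : Real.log (6 / 5) = Real.log (4 / 5) + Real.log (3 / 2) := by
    rw [← Real.log_mul (by norm_num) (by norm_num)]; norm_num
  have := Real.log_le_sub_one_of_pos (show (0 : ℝ) < 3 / 2 by norm_num)
  linarith

lemma log_six_fifths_le : Real.log (6 / 5) ≤ 1 / 5 := by
  have := Real.log_le_sub_one_of_pos (show (0 : ℝ) < 6 / 5 by norm_num)
  linarith

variable {Φ Ψ : ℝ → ℝ × ℝ → ℝ × ℝ} (h : IsHamFlow loopHam Φ) (k : IsHamFlow kickHam Ψ)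

include h in
lemma IsHamFlow.exists_time_of_mem_kickBox {p : ℝ × ℝ} (hp : p ∈ loop) (hb : p ∈ kickBox) :
    ∃ t ∈ Icc (Real.log (4 / 5)) (Real.log (6 / 5)), p = Φ t (0, 1) := by
  have hpos : 0 < p.2 := by linarith [hb.2.1]
  refine ⟨Real.log p.2, ⟨Real.log_le_log (by norm_num) hb.2.1, Real.log_le_log hpos hb.2.2⟩, ?_⟩
  rw [h.apply_unstable, Real.exp_log hpos, ← mem_loop_inter_kickBox hp hb]
  exact (Real.log_le_log hpos hb.2.2).trans (log_six_fifths_le.trans (by norm_num))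

include h in
lemma IsHamFlow.mem_kickBox_iff (t : ℝ) :
    Φ t (0, 1) ∈ kickBox ↔ t ∈ Icc (Real.log (4 / 5)) (Real.log (6 / 5)) := by
  constructor
  · intro hb
    obtain ⟨s, hs, hst⟩ := h.exists_time_of_mem_kickBox
      (h.apply_mem_loop axis_mem_loop_diff.1.1 t) hb
    rwa [h.time_injective axis_mem_loop_diff.1 hst]
  · intro ht
    rw [h.apply_unstable (ht.2.trans (log_six_fifths_le.trans (by norm_num)))]
    refine ⟨by norm_num, ?_, ?_⟩
    · rw [← Real.log_le_iff_le_exp (by norm_num)]; exact ht.1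
    · rw [← Real.le_log_iff_exp_le (by norm_num)]; exact ht.2

include k in
lemma IsHamFlow.kick_mem_loop {p : ℝ × ℝ} (hp : p ∈ loop) (t : ℝ) : Ψ t p ∈ loop := by
  by_cases hb : p ∈ kickBox
  · have h1 := k.kick_mem_box hb t
    have h0 : p = (0, p.2) := Prod.ext (mem_loop_inter_kickBox hp hb) rfl
    have h2 : (Ψ t p).1 = 0 := by rw [h0]; exact k.kick_axis t _
    refine ⟨?_, ?_⟩
    · rw [loopHam_of_le (by linarith [h1.1.2, h1.2.2]), h2, zero_mul]
    · linarith [h1.2.1]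
  · rwa [k.kick_eq_self hb]

include h k in
lemma IsHamFlow.exists_kick_eq {t : ℝ} (ht : t ∈ Icc (Real.log (4 / 5)) (Real.log (6 / 5)))
    (s : ℝ) : ∃ t' ∈ Icc (Real.log (4 / 5)) (Real.log (6 / 5)),
      Ψ s (Φ t (0, 1)) = Φ t' (0, 1) :=
  h.exists_time_of_mem_kickBox (k.kick_mem_loop (h.apply_mem_loop axis_mem_loop_diff.1.1 t) s)
    (k.kick_mem_box ((h.mem_kickBox_iff t).2 ht) s)

/-- The perturbed map. -/
noncomputable def perturbedMap : Equiv.Perm (ℝ × ℝ) := h.perm 1 * k.perm 1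

lemma perturbedMap_apply (p : ℝ × ℝ) : perturbedMap h k p = Φ 1 (Ψ 1 p) := rfl

lemma perturbedMap_inv_apply (p : ℝ × ℝ) : (perturbedMap h k)⁻¹ p = Ψ (-1) (Φ (-1) p) := rfl

lemma isSymplecticDiffeo_perturbedMap : IsSymplecticDiffeo (perturbedMap h k) :=
  (h.isSymplecticDiffeo_perm 1).mul (k.isSymplecticDiffeo_perm 1)

lemma perturbedMap_of_notMem {p : ℝ × ℝ} (hp : p ∉ kickBox) : perturbedMap h k p = Φ 1 p := by
  rw [perturbedMap_apply, k.kick_eq_self hp]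

lemma perturbedMap_loop_curve {t : ℝ} (ht : t ∉ Icc (Real.log (4 / 5)) (Real.log (6 / 5))) :
    perturbedMap h k (Φ t (0, 1)) = Φ (t + 1) (0, 1) := by
  rw [perturbedMap_of_notMem h k (by rwa [h.mem_kickBox_iff]), ← h.add, add_comm]

lemma perturbedMap_inv_loop_curve {t : ℝ}
    (ht : t - 1 ∉ Icc (Real.log (4 / 5)) (Real.log (6 / 5))) :
    (perturbedMap h k)⁻¹ (Φ t (0, 1)) = Φ (t - 1) (0, 1) := by
  rw [perturbedMap_inv_apply, ← h.add, show -1 + t = t - 1 by ring,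
    k.kick_eq_self (by rwa [h.mem_kickBox_iff])]

lemma tendsto_pow_of_apply {f : Equiv.Perm (ℝ × ℝ)} {p : ℝ × ℝ}
    (hf : Tendsto (fun n : ℕ => (f ^ n) (f p)) atTop (𝓝 0)) :
    Tendsto (fun n : ℕ => (f ^ n) p) atTop (𝓝 0) := by
  rw [← tendsto_add_atTop_iff_nat 1]
  simpa only [pow_succ, Equiv.Perm.mul_apply] using hf

/-- Past the box the map is the time-one flow (`hA`). Each step before the box adds 1 to the time,
and a kicked point lands past the box, so `hB` counts the steps left. -/
lemma tendsto_pow_perturbedMap_curve (t : ℝ) :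
    Tendsto (fun n : ℕ => (perturbedMap h k ^ n) (Φ t (0, 1))) atTop (𝓝 0) := by
  have hA : ∀ t, Real.log (6 / 5) < t →
      Tendsto (fun n : ℕ => (perturbedMap h k ^ n) (Φ t (0, 1))) atTop (𝓝 0) := by
    intro t ht
    have hn : ∀ n : ℕ, (perturbedMap h k ^ n) (Φ t (0, 1)) = Φ (t + n) (0, 1) := by
      intro n
      induction n with
      | zero => simp
      | succ n ih =>
        have h0 : (0 : ℝ) ≤ n := n.cast_nonneg
        rw [pow_succ', Equiv.Perm.mul_apply, ih,
          perturbedMap_loop_curve h k fun hmem => by linarith [hmem.2]]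
        push_cast; rw [add_assoc]
    simp_rw [hn]
    exact (h.tendsto_atTop axis_mem_loop_diff.1.1).comp
      (tendsto_atTop_add_const_left _ t tendsto_natCast_atTop_atTop)
  have hB : ∀ m : ℕ, ∀ t, Real.log (4 / 5) - m ≤ t →
      Tendsto (fun n : ℕ => (perturbedMap h k ^ n) (Φ t (0, 1))) atTop (𝓝 0) := by
    intro m
    induction m with
    | zero =>
      intro t ht
      rcases le_or_gt t (Real.log (6 / 5)) with h1 | h1
      · obtain ⟨t', ht', heq⟩ := h.exists_kick_eq k ⟨by simpa using ht, h1⟩ 1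
        apply tendsto_pow_of_apply
        rw [perturbedMap_apply, heq, ← h.add]
        exact hA _ (by linarith [ht'.1, log_six_fifths_lt])
      · exact hA t h1
    | succ m ih =>
      intro t ht
      push_cast at ht
      rcases le_or_gt (Real.log (4 / 5)) t with h1 | h1
      · exact ih t (by linarith [(m.cast_nonneg : (0 : ℝ) ≤ m)])
      · apply tendsto_pow_of_apply
        rw [perturbedMap_loop_curve h k fun hmem => by linarith [hmem.1]]
        exact ih _ (by linarith)
  obtain ⟨m, hm⟩ := exists_nat_ge (Real.log (4 / 5) - t)
  exact hB m t (by linarith)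

lemma tendsto_inv_pow_perturbedMap_curve (t : ℝ) :
    Tendsto (fun n : ℕ => ((perturbedMap h k)⁻¹ ^ n) (Φ t (0, 1))) atTop (𝓝 0) := by
  have hA : ∀ t, t < Real.log (4 / 5) + 1 →
      Tendsto (fun n : ℕ => ((perturbedMap h k)⁻¹ ^ n) (Φ t (0, 1))) atTop (𝓝 0) := by
    intro t ht
    have hn : ∀ n : ℕ, ((perturbedMap h k)⁻¹ ^ n) (Φ t (0, 1)) = Φ (t - n) (0, 1) := by
      intro n
      induction n with
      | zero => simp
      | succ n ih =>
        have h0 : (0 : ℝ) ≤ n := n.cast_nonneg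
        rw [pow_succ', Equiv.Perm.mul_apply, ih,
          perturbedMap_inv_loop_curve h k fun hmem => by linarith [hmem.1]]
        push_cast; rw [sub_sub]
    simp_rw [hn]
    exact (h.tendsto_atBot axis_mem_loop_diff.1.1).comp
      (tendsto_atBot_add_const_left _ t (tendsto_neg_atTop_atBot.comp tendsto_natCast_atTop_atTop))
  have hB : ∀ m : ℕ, ∀ t, t < Real.log (4 / 5) + 1 + m →
      Tendsto (fun n : ℕ => ((perturbedMap h k)⁻¹ ^ n) (Φ t (0, 1))) atTop (𝓝 0) := by
    intro m
    induction m with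
    | zero => intro t ht; exact hA t (by simpa using ht)
    | succ m ih =>
      intro t ht
      push_cast at ht
      -- The inverse flows back first and then undoes the kick, so the time to test is `t - 1`.
      by_cases h1 : t - 1 ∈ Icc (Real.log (4 / 5)) (Real.log (6 / 5))
      · obtain ⟨t', ht', heq⟩ := h.exists_kick_eq k h1 (-1)
        apply tendsto_pow_of_apply
        rw [perturbedMap_inv_apply, ← h.add, show -1 + t = t - 1 by ring, heq]
        exact hA _ (by linarith [ht'.2, log_six_fifths_lt])
      · apply tendsto_pow_of_apply
        rw [perturbedMap_inv_loop_curve h k h1]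
        exact ih _ (by linarith)
  obtain ⟨m, hm⟩ := exists_nat_ge (t - Real.log (4 / 5))
  exact hB m t (by linarith)

lemma perturbedMap_zero : perturbedMap h k 0 = 0 := by
  rw [perturbedMap_of_notMem h k (fun hb => by have := hb.2.1; norm_num at this), h.apply_zero]

lemma tendsto_zpow_atTop_of_pow {f : Equiv.Perm (ℝ × ℝ)} {p : ℝ × ℝ}
    (hf : Tendsto (fun n : ℕ => (f ^ n) p) atTop (𝓝 0)) :
    Tendsto (fun n : ℤ => (f ^ n) p) atTop (𝓝 0) := by
  have h1 : Tendsto Int.toNat atTop atTop := tendsto_atTop.2 fun b => by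
    filter_upwards [eventually_ge_atTop (b : ℤ)] with n hn
    omega
  refine (hf.comp h1).congr' ?_
  filter_upwards [eventually_ge_atTop (0 : ℤ)] with n hn
  rw [Function.comp_apply, ← zpow_natCast, Int.toNat_of_nonneg hn]

lemma tendsto_zpow_atBot_of_pow {f : Equiv.Perm (ℝ × ℝ)} {p : ℝ × ℝ}
    (hf : Tendsto (fun n : ℕ => (f⁻¹ ^ n) p) atTop (𝓝 0)) :
    Tendsto (fun n : ℤ => (f ^ n) p) atBot (𝓝 0) := by
  have := (tendsto_zpow_atTop_of_pow hf).comp (tendsto_neg_atBot_atTop (G := ℤ))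
  refine this.congr fun n => ?_
  rw [Function.comp_apply, inv_zpow', neg_neg]

lemma eventually_perturbedMap_eq : ∀ᶠ p in 𝓝 (0 : ℝ × ℝ),
    perturbedMap h k p = (Real.exp (-1) * p.1, Real.exp 1 * p.2) := by
  have h0 : (0 : ℝ × ℝ) ∈ kickBoxᶜ := fun hb => by have := hb.2.1; norm_num at this
  filter_upwards [isCompact_kickBox.isClosed.isOpen_compl.mem_nhds h0, h.eventually_eq_linear]
    with p hp hlin
  rw [perturbedMap_of_notMem h k hp, hlin]

lemma image_perturbedMap_loop : perturbedMap h k '' loop = loop := by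
  refine Subset.antisymm (image_subset_iff.2 fun p hp =>
    h.apply_mem_loop (k.kick_mem_loop hp 1) 1) fun p hp => ?_
  exact ⟨(perturbedMap h k)⁻¹ p, k.kick_mem_loop (h.apply_mem_loop hp _) _,
    (perturbedMap h k).apply_symm_apply p⟩

lemma isSeparatrix_perturbedMap : IsSeparatrix (perturbedMap h k) loop where
  hyperbolic := isHyperbolicFixedPt_of_eventually (eventually_perturbedMap_eq h k)
  isCompact := isCompact_loop
  isConnected := isConnected_loop
  zero_mem := zero_mem_loop
  invariant := image_perturbedMap_loop h k
  isConnected_diff := isConnected_loop_diff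
  isSmoothCurve_diff := isSmoothCurve_loop_diff
  tendsto_forward p hp := by
    by_cases h0 : p = 0
    · refine tendsto_const_nhds.congr fun n => ?_
      rw [h0, Function.IsFixedPt.perm_zpow (perturbedMap_zero h k)]
    · obtain ⟨t, rfl⟩ := h.exists_eq_of_mem_loop axis_mem_loop_diff.1 ⟨hp, h0⟩
      exact tendsto_zpow_atTop_of_pow (tendsto_pow_perturbedMap_curve h k t)
  tendsto_backward p hp := by
    by_cases h0 : p = 0
    · refine tendsto_const_nhds.congr fun n => ?_
      rw [h0, Function.IsFixedPt.perm_zpow (perturbedMap_zero h k)]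
    · obtain ⟨t, rfl⟩ := h.exists_eq_of_mem_loop axis_mem_loop_diff.1 ⟨hp, h0⟩
      exact tendsto_zpow_atBot_of_pow (tendsto_inv_pow_perturbedMap_curve h k t)

lemma isLocalPerturbation_perturbedMap : IsLocalPerturbation (perturbedMap h k) loop := by
  refine ⟨loopHam, {p | p.1 + p.2 < 4}, kickBox, h.perm 1, contDiff_loopHam,
    isOpen_lt (continuous_fst.add continuous_snd) continuous_const, by simp,
    fun p hp => loopHam_of_le (le_of_lt hp), h.isTimeOneMap, h.isSeparatrix_loop,
    isCompact_kickBox, fun p hp => ⟨?_, ?_⟩, fun p hp => perturbedMap_of_notMem h k hp⟩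
  · rw [mem_ofPred_eq]
    linarith [hp.1.2, hp.2.2]
  · rintro rfl
    have := hp.2.1
    norm_num at this

end Perturbation

/-! ### The drifting orbit -/

/-- An expanding affine recursion with bounded inhomogeneity has a bounded solution. -/
lemma exists_bounded_solution {a δ : ℝ} (ha : 2 ≤ a) (hδ : 0 ≤ δ) {ε : ℕ → ℝ}
    (hε : ∀ k, |ε k| ≤ δ) :
    ∃ t : ℕ → ℝ, (∀ k, |t k| ≤ δ) ∧ ∀ k, t (k + 1) = a * t k + ε k := by
  have ha0 : 0 < a := by linarith
  have hr1 : a⁻¹ ≤ 1 / 2 := by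
    rw [one_div]; exact inv_anti₀ (by norm_num) ha
  have hr0 : 0 < a⁻¹ := inv_pos.2 ha0
  have hgeo : Summable fun j : ℕ => (a⁻¹) ^ (j + 1) * δ :=
    (((summable_geometric_of_lt_one hr0.le (by linarith)).mul_left a⁻¹).congr
      fun j => (pow_succ' _ _).symm).mul_right δ
  have hle : ∀ k j, |(a⁻¹) ^ (j + 1) * ε (k + j)| ≤ (a⁻¹) ^ (j + 1) * δ := fun k j => by
    rw [abs_mul, abs_of_pos (pow_pos hr0 _)]
    exact mul_le_mul_of_nonneg_left (hε _) (pow_pos hr0 _).le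
  have hsum : ∀ k, Summable fun j : ℕ => (a⁻¹) ^ (j + 1) * ε (k + j) := fun k =>
    Summable.of_norm_bounded hgeo (hle k)
  -- The recursion is solved backwards from infinity by iterating t_k = (t_{k+1} - ε_k)/a; since a ≥
  -- 2 the weights sum to at most 1.
  refine ⟨fun k => -∑' j : ℕ, (a⁻¹) ^ (j + 1) * ε (k + j), fun k => ?_, fun k => ?_⟩
  · rw [abs_neg]
    have h1 := tsum_of_norm_bounded (f := fun j : ℕ => (a⁻¹) ^ (j + 1) * ε (k + j)) hgeo.hasSum
      (hle k)
    refine h1.trans ?_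
    rw [tsum_mul_right]
    have h2 : ∑' j : ℕ, (a⁻¹) ^ (j + 1) = a⁻¹ * (1 - a⁻¹)⁻¹ := by
      simp_rw [pow_succ']
      rw [tsum_mul_left, tsum_geometric_of_lt_one hr0.le (by linarith)]
    have h3 : a⁻¹ * (1 - a⁻¹)⁻¹ ≤ 1 := by
      rw [← div_eq_mul_inv, div_le_one (by linarith)]
      linarith
    rw [h2]
    nlinarith
  · beta_reduce
    rw [(hsum k).tsum_eq_zero_add]
    simp only [zero_add, pow_one, add_zero]
    have h1 : ∑' j : ℕ, (a⁻¹) ^ (j + 1 + 1) * ε (k + (j + 1)) =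
        a⁻¹ * ∑' j : ℕ, (a⁻¹) ^ (j + 1) * ε (k + 1 + j) := by
      rw [← tsum_mul_left]
      refine tsum_congr fun j => ?_
      rw [pow_succ' _ (j + 1), mul_assoc, show k + (j + 1) = k + 1 + j by ring]
    rw [h1]
    field_simp
    ring

/-- The point with energy `a` and logarithmic height `t` in the linear region. -/
noncomputable def linearPoint (t a : ℝ) : ℝ × ℝ := (a * Real.exp (-t), Real.exp t)

section Drift

variable {Φ Ψ : ℝ → ℝ × ℝ → ℝ × ℝ} (h : IsHamFlow loopHam Φ) (k : IsHamFlow kickHam Ψ)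

include h in
lemma IsHamFlow.linearPoint_eq {t a : ℝ} (ht : |t| ≤ 1 / 20) (ha : 0 ≤ a) (ha1 : a ≤ 1) :
    linearPoint t a = Φ t (a, 1) := by
  rw [abs_le] at ht
  have h1 : Real.exp (-t) < 2 := by
    rw [← Real.lt_log_iff_exp_lt (by norm_num)]; linarith [Real.log_two_gt_d9]
  have h2 : Real.exp t < 2 := by
    rw [← Real.lt_log_iff_exp_lt (by norm_num)]; linarith [Real.log_two_gt_d9]
  have h3 := Real.exp_pos (-t)
  have := h.eq_linear (p := (a, 1)) (t := t) ha zero_le_one (by simp; linarith)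
    (by simp only [mul_one]; nlinarith)
  rw [this, linearPoint, mul_one, mul_comm]

include h in
/-- The unstable branch of the loop comes back to the stable axis at an integer time. -/
lemma IsHamFlow.exists_return_time : ∃ (N : ℕ) (c : ℝ), 1 ≤ N ∧ 0 < c ∧ c ≤ 1 ∧
    Φ N (0, 1) = (c, 0) := by
  obtain ⟨T, hT⟩ := h.exists_eq_of_mem_loop axis_mem_loop_diff.1 axis_mem_loop_diff.2
  obtain ⟨N, hN⟩ := exists_nat_ge (max T 1)
  have hN1 : T ≤ N := (le_max_left _ _).trans hN
  refine ⟨N, Real.exp (-(N - T)), by exact_mod_cast (le_max_right _ _).trans hN, Real.exp_pos _,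
    Real.exp_le_one_iff.2 (by linarith), ?_⟩
  rw [← h.apply_stable (by linarith), hT, ← h.add, sub_add_cancel]

include h in
-- At energy 0 the point is on the loop at time t + j ≥ 19/20 > log(6/5), past the box; compactness
-- in `t` extends this to small energies.
lemma IsHamFlow.eventually_avoid {j : ℕ} (hj : 1 ≤ j) :
    ∀ᶠ a in 𝓝 (0 : ℝ), ∀ t ∈ Icc (-(1 / 20) : ℝ) (1 / 20), Φ j (linearPoint t a) ∉ kickBox := by
  refine isCompact_Icc.eventually_forall_of_forall_eventually fun t ht => ?_
  have hcont : Continuous fun z : ℝ × ℝ => Φ j (linearPoint z.2 z.1) := by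
    have := h.continuous j
    unfold linearPoint
    fun_prop
  refine hcont.continuousAt.eventually
    (isCompact_kickBox.isClosed.isOpen_compl.mem_nhds ?_)
  have e1 : linearPoint t 0 = Φ t (0, 1) :=
    h.linearPoint_eq (abs_le.2 ht) le_rfl zero_le_one
  change Φ j (linearPoint t 0) ∉ kickBox
  rw [e1, ← h.add, h.mem_kickBox_iff]
  intro hmem
  have h1 : (1 : ℝ) ≤ j := by exact_mod_cast hj
  linarith [hmem.2, ht.1, log_six_fifths_le]

/-- One passage of the perturbed map around the loop, in the coordinates of `linearPoint`. -/
lemma exists_passage {δ : ℝ} (hδ : 0 < δ) (hδ1 : δ ≤ 1 / 60) :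
    ∃ (N : ℕ) (L : ℝ → ℝ) (b : ℝ), 0 < b ∧ b ≤ 1 / 20 ∧ 1 ≤ N ∧
      (∀ a, 0 < a → a < b → |L 0 - L a| ≤ δ) ∧
      ∀ a, 0 < a → a < b → ∀ t t' : ℝ, ∀ n : ℕ, |t| ≤ 1 / 60 → |t'| ≤ 1 / 60 →
        t' = Real.exp 1 * t + n + Real.log a - L a →
        (perturbedMap h k ^ (N + n)) (linearPoint t (a * Real.exp 1)) = linearPoint t' a := by
  obtain ⟨N, c, hN, hc, hc1, hNc⟩ := h.exists_return_time
  have hcN := h.continuous N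
  have hcm : Continuous fun a : ℝ => Φ N (a, 1) := by fun_prop
  have hm0 : (Φ N (0, 1)).1 = c := by rw [hNc]
  have ev1 : ∀ᶠ a in 𝓝 (0 : ℝ), 0 < (Φ N (a, 1)).1 :=
    (continuous_fst.comp hcm).continuousAt.eventually_const_lt (by
      rw [Function.comp_apply, hm0]; exact hc)
  have ev2 : ∀ᶠ a in 𝓝 (0 : ℝ), (Φ N (a, 1)).1 < 2 :=
    (continuous_fst.comp hcm).continuousAt.eventually_lt_const (by
      rw [Function.comp_apply, hm0]; linarith)
  have ev3 : ∀ᶠ a in 𝓝 (0 : ℝ), (Φ N (a, 1)).1 + (Φ N (a, 1)).2 < 4 :=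
    ((continuous_fst.comp hcm).add (continuous_snd.comp hcm)).continuousAt.eventually_lt_const (by
      change (Φ N (0, 1)).1 + (Φ N (0, 1)).2 < 4
      rw [hNc, add_zero]; linarith)
  have hlog : ContinuousAt (fun a => Real.log (Φ N (a, 1)).1) 0 :=
    (continuous_fst.comp hcm).continuousAt.log (by
      rw [Function.comp_apply, hm0]; exact hc.ne')
  have ev4 : ∀ᶠ a in 𝓝 (0 : ℝ), |Real.log (Φ N (0, 1)).1 - Real.log (Φ N (a, 1)).1| < δ :=
    (continuousAt_const.sub hlog).abs.eventually_lt_const (by simpa using hδ)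
  have ev5 : ∀ᶠ a in 𝓝 (0 : ℝ), ∀ j ∈ Finset.Icc 1 N, ∀ t ∈ Icc (-(1 / 20) : ℝ) (1 / 20),
      Φ j (linearPoint t a) ∉ kickBox :=
    (Finset.eventually_all _).2 fun j hj => h.eventually_avoid (Finset.mem_Icc.1 hj).1
  obtain ⟨b, hb, hball⟩ := Metric.eventually_nhds_iff.1
    (ev1.and (ev2.and (ev3.and (ev4.and ev5))))
  refine ⟨N, fun a => Real.log (Φ N (a, 1)).1, min b (1 / 20), by positivity, min_le_right _ _, hN,
    fun a ha hab => ?_, fun a ha hab t t' n ht ht' heq => ?_⟩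
  · exact (hball (y := a) (by
      rw [Real.dist_eq, sub_zero, abs_of_pos ha]; exact hab.trans_le (min_le_left _ _))).2.2.2.1.le
  obtain ⟨hm, hm2, hs4, -, havoid⟩ := hball (y := a) (by
    rw [Real.dist_eq, sub_zero, abs_of_pos ha]; exact hab.trans_le (min_le_left _ _))
  have ha20 : a < 1 / 20 := hab.trans_le (min_le_right _ _)
  set m : ℝ := (Φ N (a, 1)).1 with hmdef
  -- Energy is conserved, and it equals xy at both ends.
  have hY : Φ N (a, 1) = (m, a / m) := by
    refine Prod.ext rfl ?_
    have h1 := h.ham_apply N (a, 1)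
    rw [loopHam_of_le hs4.le, loopHam_of_le (by simp only; linarith)] at h1
    rw [eq_div_iff hm.ne', mul_comm, hmdef, h1, mul_one]
  have hsum4 : m + a / m ≤ 4 := by
    have h1 := congrArg Prod.snd hY
    simp only at h1
    linarith
  set u : ℝ := Real.exp 1 * t with hu
  have he3 : Real.exp 1 < 3 := by linarith [Real.exp_one_lt_d9]
  have hu20 : |u| ≤ 1 / 20 := by
    rw [hu, abs_mul, Real.abs_exp]
    nlinarith [abs_nonneg t, Real.exp_pos 1]
  have hu' := abs_le.1 hu20
  have hkick : Ψ 1 (linearPoint t (a * Real.exp 1)) = linearPoint u a := by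
    have h1 := k.kick_apply (t := t) (a := a * Real.exp 1) ht (by
      rw [abs_mul, abs_of_pos ha, Real.abs_exp]
      nlinarith)
    rw [linearPoint, h1, linearPoint, mul_assoc a, ← Real.exp_add, add_neg_cancel, Real.exp_zero,
      mul_one]
  have hstart : linearPoint u a = Φ u (a, 1) := h.linearPoint_eq hu20 ha.le (by linarith)
  -- After time `N` the orbit follows the linear saddle; the relation defining `t'` says that the
  -- height is e^{t'} at `i = n`.
  have hlin : ∀ i : ℕ, i ≤ n → Φ (N + i : ℕ) (linearPoint u a) =
      (m * Real.exp (-(i + u)), Real.exp (t' - (n - i))) := by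
    intro i hi
    have hin : (i : ℝ) ≤ n := by exact_mod_cast hi
    have hi0 : (0 : ℝ) ≤ i := i.cast_nonneg
    have e1 : Φ (N + i : ℕ) (linearPoint u a) = Φ (i + u) (m, a / m) := by
      rw [hstart, ← h.add, ← hY, ← h.add]
      congr 1
      push_cast; ring
    have e2 : Real.exp (i + u) * (a / m) = Real.exp (t' - (n - i)) := by
      have : a / m = Real.exp (Real.log a - Real.log m) := by
        rw [Real.exp_sub, Real.exp_log ha, Real.exp_log hm]
      rw [this, ← Real.exp_add, heq]
      congr 1
      ring
    have b1 : Real.exp (-(i + u)) ≤ 4 / 3 := by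
      rw [← Real.le_log_iff_exp_le (by norm_num)]
      have := Real.one_sub_inv_le_log_of_pos (show (0 : ℝ) < 4 / 3 by norm_num)
      norm_num at this
      linarith
    have b2 : Real.exp (t' - (n - i)) ≤ 4 / 3 := by
      rw [← Real.le_log_iff_exp_le (by norm_num)]
      have := Real.one_sub_inv_le_log_of_pos (show (0 : ℝ) < 4 / 3 by norm_num)
      norm_num at this
      linarith [(abs_le.1 ht').2]
    rw [e1, h.eq_linear (p := (m, a / m)) hm.le (div_pos ha hm).le hsum4
      (by rw [e2]; simp only; nlinarith [Real.exp_pos (-(i + u))]), e2, mul_comm]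
  -- Only the first iterate is kicked: times 1 to `N` avoid the box by `havoid`, and from then until
  -- the last step the height is below 4/5.
  have hiter : ∀ i : ℕ, i < N + n → (perturbedMap h k ^ (i + 1)) (linearPoint t (a * Real.exp 1)) =
      Φ (i + 1 : ℕ) (linearPoint u a) := by
    intro i
    induction i with
    | zero =>
      intro _
      rw [zero_add, pow_one, perturbedMap_apply, hkick, Nat.cast_one]
    | succ i ih =>
      intro hi
      rw [pow_succ', Equiv.Perm.mul_apply, ih (by omega), perturbedMap_of_notMem, ← h.add]
      · congr 1
        push_cast; ring
      · by_cases hiN : i + 1 ≤ N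
        · exact havoid (i + 1) (Finset.mem_Icc.2 ⟨by omega, hiN⟩) u hu'
        · obtain ⟨r, hr⟩ := Nat.exists_eq_add_of_le (not_le.1 hiN).le
          rw [hr, hlin r (by omega)]
          intro hbox
          have h1 : (r : ℝ) + 1 ≤ n := by
            have : r + 1 ≤ n := by omega
            exact_mod_cast this
          have h2 : Real.exp (t' - (n - r)) < 4 / 5 := by
            rw [← Real.lt_log_iff_exp_lt (by norm_num)]
            have := Real.one_sub_inv_le_log_of_pos (show (0 : ℝ) < 4 / 5 by norm_num)
            norm_num at this
            linarith [(abs_le.1 ht').2]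
          exact absurd hbox.2.1 (not_le.2 h2)
  obtain ⟨M, hM⟩ : ∃ M, N + n = M + 1 := ⟨N + n - 1, by omega⟩
  have hend : (perturbedMap h k ^ (N + n)) (linearPoint t (a * Real.exp 1)) =
      Φ (N + n : ℕ) (linearPoint u a) := by
    rw [hM]
    exact hiter M (by omega)
  rw [hend, hlin n le_rfl, sub_self, sub_zero, linearPoint]
  congr 1
  have hexp : Real.exp (Real.log a - Real.log m) = a / m := by
    rw [Real.exp_sub, Real.exp_log ha, Real.exp_log hm]
  rw [show -t' = -(n + u) - (Real.log a - Real.log m) by rw [heq]; ring,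
    Real.exp_sub, hexp]
  field_simp

/-- Some orbit of the perturbed map inside the loop accumulates on the loop. -/
theorem exists_drifting_orbit : ∃ z ∈ loopInterior, ∃ p : ℕ → ℕ, Tendsto p atTop atTop ∧
    Tendsto (fun n => Metric.infDist ((perturbedMap h k ^ p n) z) loop) atTop (𝓝 0) := by
  obtain ⟨N, L, b, hb, hb20, hN, hL, hpass⟩ := exists_passage h k (δ := 1 / 60) (by norm_num) le_rfl
  obtain ⟨n₀, hn₀⟩ := exists_nat_gt (1 + L 0 - Real.log b)
  -- Since log E(j + 1) = L(0) - (n₀ + j), taking n = n₀ + j leaves t' = et + L(0) - L(E(j + 1)).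
  -- The choice of `n₀` makes E(0) < b.
  let E : ℕ → ℝ := fun j => Real.exp (1 - n₀ + L 0 - j)
  have hE0 : ∀ j, 0 < E j := fun j => Real.exp_pos _
  have hEb : ∀ j, E j < b := fun j => by
    rw [← Real.lt_log_iff_exp_lt hb]
    linarith [(j.cast_nonneg : (0 : ℝ) ≤ j)]
  have hEs : ∀ j, E j = E (j + 1) * Real.exp 1 := fun j => by
    simp only [E]
    rw [← Real.exp_add]; congr 1; push_cast; ring
  obtain ⟨t, ht, htrec⟩ := exists_bounded_solution (a := Real.exp 1) (δ := 1 / 60)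
    (ε := fun j => L 0 - L (E (j + 1))) (by linarith [Real.exp_one_gt_d9]) (by norm_num)
    (fun j => hL _ (hE0 _) (hEb _))
  have hstep : ∀ j, (perturbedMap h k ^ (N + (n₀ + j))) (linearPoint (t j) (E j)) =
      linearPoint (t (j + 1)) (E (j + 1)) := fun j => by
    rw [hEs j]
    refine hpass _ (hE0 _) (hEb _) _ _ _ (ht _) (ht _) ?_
    rw [htrec]
    simp only [E, Real.log_exp]
    push_cast
    ring
  let p : ℕ → ℕ := fun j => ∑ i ∈ Finset.range j, (N + (n₀ + i))
  have hp : ∀ j, (perturbedMap h k ^ p j) (linearPoint (t 0) (E 0)) = linearPoint (t j) (E j) := by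
    intro j
    induction j with
    | zero => simp [p]
    | succ j ih =>
      have : p (j + 1) = (N + (n₀ + j)) + p j := by
        simp only [p]; rw [Finset.sum_range_succ, add_comm]
      rw [this, pow_add, Equiv.Perm.mul_apply, ih, hstep]
  have hexp2 : ∀ j, Real.exp (-(t j)) < 2 := fun j => by
    rw [← Real.lt_log_iff_exp_lt (by norm_num)]
    linarith [Real.log_two_gt_d9, (abs_le.1 (ht j)).1]
  have hexp2' : ∀ j, Real.exp (t j) < 2 := fun j => by
    rw [← Real.lt_log_iff_exp_lt (by norm_num)]
    linarith [Real.log_two_gt_d9, (abs_le.1 (ht j)).2]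
  refine ⟨linearPoint (t 0) (E 0), ⟨?_, ?_⟩, p, ?_, ?_⟩
  · have h1 : E 0 * Real.exp (-(t 0)) ≤ 1 / 20 * 2 := by
      have := hEb 0
      have := hexp2 0
      have := Real.exp_pos (-(t 0))
      nlinarith [hE0 0]
    rw [loopHam_of_le (by
      simp only [linearPoint]
      linarith [hexp2' 0])]
    have := hE0 0
    simp only [linearPoint]
    positivity
  · have := hE0 0
    simp only [linearPoint]
    positivity
  · refine tendsto_atTop_mono (fun j => ?_) tendsto_id
    have : ∑ i ∈ Finset.range j, 1 ≤ p j := Finset.sum_le_sum fun i _ => by omega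
    simpa using this
  · have hEt : Tendsto (fun j : ℕ => 2 * E j) atTop (𝓝 0) := by
      have h1 : Tendsto (fun j : ℕ => 1 - (n₀ : ℝ) + L 0 - j) atTop atBot :=
        tendsto_atBot_add_const_left _ _ (tendsto_neg_atTop_atBot.comp tendsto_natCast_atTop_atTop)
      simpa using (Real.tendsto_exp_atBot.comp h1).const_mul 2
    refine squeeze_zero (fun j => Metric.infDist_nonneg) (fun j => ?_) hEt
    rw [hp]
    have hmem : ((0 : ℝ), Real.exp (t j)) ∈ loop := by
      refine ⟨?_, by simpa using (Real.exp_pos (t j)).le⟩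
      rw [loopHam_of_le (by simp only [zero_add]; linarith [hexp2' j]), zero_mul]
    refine (Metric.infDist_le_dist_of_mem hmem).trans ?_
    have h1 := hE0 j
    rw [linearPoint, Prod.dist_eq, dist_self, Real.dist_eq, sub_zero,
      abs_of_pos (by positivity), max_eq_left (by positivity)]
    nlinarith [hexp2 j]

end Drift

/-! ### Exclusion of invariant circles -/

lemma IsCircle.isCompact {C : Set (ℝ × ℝ)} (hC : IsCircle C) : IsCompact C := by
  obtain ⟨γ, hγ, -, rfl⟩ := hC
  exact isCompact_range hγ

lemma IsCircle.isConnected {C : Set (ℝ × ℝ)} (hC : IsCircle C) : IsConnected C := by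
  obtain ⟨γ, hγ, -, rfl⟩ := hC
  exact isConnected_range hγ

/-- The component of the complement of an invariant set that contains an invariant compact
connected set also contains every orbit that accumulates on the latter. -/
lemma mem_connectedComponentIn_of_tendsto_infDist (f : (ℝ × ℝ) ≃ₜ (ℝ × ℝ)) {C S : Set (ℝ × ℝ)}
    (hC : IsClosed C) (hfC : f '' C = C) (hS : IsCompact S) (hSc : IsPreconnected S)
    (hSC : S ⊆ Cᶜ) {o : ℝ × ℝ} (ho : o ∈ S) (hfo : f o = o) {z : ℝ × ℝ} {p : ℕ → ℕ}
    (hz : Tendsto (fun n => Metric.infDist (f^[p n] z) S) atTop (𝓝 0)) :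
    z ∈ connectedComponentIn Cᶜ o := by
  have hU : f '' connectedComponentIn Cᶜ o = connectedComponentIn Cᶜ o := by
    rw [f.image_connectedComponentIn (hSC ho), image_compl_eq f.bijective, hfC, hfo]
  have hback : ∀ n : ℕ, ∀ q, f^[n] q ∈ connectedComponentIn Cᶜ o →
      q ∈ connectedComponentIn Cᶜ o := by
    intro n
    induction n with
    | zero => exact fun q hq => hq
    | succ n ih =>
      intro q hq
      have := ih (f q) hq
      rw [← hU] at this
      exact f.injective.mem_set_image.1 this
  obtain ⟨δ, hδ, hsub⟩ := hS.exists_thickening_subset_open hC.isOpen_compl.connectedComponentIn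
    (hSc.subset_connectedComponentIn ho hSC)
  obtain ⟨n, hn⟩ := (hz.eventually_lt_const hδ).exists
  exact hback (p n) z (hsub ((Metric.mem_thickening_iff_infDist_lt ⟨o, ho⟩).2 hn))

/-- The centre and any point inside the loop are joined in a superlevel set of the Hamiltonian. -/
lemma loopCenter_mem_connectedComponentIn {C : Set (ℝ × ℝ)} {z : ℝ × ℝ} (hz : z ∈ loopInterior)
    (hC : ∀ w ∈ C, loopHam w < loopHam z) : loopCenter ∈ connectedComponentIn Cᶜ z := by
  have hpre : IsPreconnected ((fun r : ℝ => loopCenter + r • (z - loopCenter)) '' Icc 0 1) :=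
    isPreconnected_Icc.image _ (by fun_prop)
  refine hpre.subset_connectedComponentIn ⟨1, by simp, by simp⟩ ?_ ⟨0, by simp, by simp⟩
  rintro _ ⟨r, hr, rfl⟩ hmem
  have h1 := hC _ hmem
  simp only at h1
  by_cases hzc : z = loopCenter
  · rw [hzc, sub_self, smul_zero, add_zero] at h1
    exact lt_irrefl _ h1
  rcases hr.2.lt_or_eq with hr1 | hr1
  · exact lt_asymm h1 (loopHam_lt_of_ray hzc hz.2.le hr.1 hr1)
  · rw [hr1, one_smul, add_sub_cancel] at h1
    exact lt_irrefl _ h1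

lemma eq_zero_of_fixed_of_isSeparatrix {f : Equiv.Perm (ℝ × ℝ)} {S : Set (ℝ × ℝ)}
    (hf : IsSeparatrix f S) {p : ℝ × ℝ} (hp : p ∈ S) (hfix : f p = p) : p = 0 := by
  have h1 := hf.tendsto_forward p hp
  have h2 : ∀ n : ℤ, (f ^ n) p = p := fun n => Function.IsFixedPt.perm_zpow hfix n
  simp_rw [h2] at h1
  exact tendsto_nhds_unique tendsto_const_nhds h1

/-- The linear saddle moves no point of the open quadrant near the origin along the rays issued
from the centre. -/
lemma not_ray_linear {w : ℝ × ℝ} (h1 : 0 < w.1) (h2 : 0 < w.2) (h3 : w.1 < 2) (h4 : w.2 < 2)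
    {r : ℝ} (h : (Real.exp (-1) * w.1, Real.exp 1 * w.2) - loopCenter = r • (w - loopCenter)) :
    False := by
  have e1 : Real.exp (-1) * w.1 - 9 / 4 = r * (w.1 - 9 / 4) := congrArg Prod.fst h
  have e2 : Real.exp 1 * w.2 - 9 / 4 = r * (w.2 - 9 / 4) := congrArg Prod.snd h
  have h5 : Real.exp (-1) < 1 := (Real.exp_lt_exp.2 (by norm_num : (-1 : ℝ) < 0)).trans_eq Real.exp_zero
  have h6 : 1 < Real.exp 1 := Real.one_lt_exp_iff.2 (by norm_num)
  -- Contraction of x increases 9/4 - x and forces r > 1; expansion of y decreases 9/4 - y and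
  -- forces r < 1.
  have h7 : 1 < r := by
    by_contra hcon
    nlinarith
  nlinarith

theorem theoremB :
    ∃ (f : Equiv.Perm (ℝ × ℝ)) (S W : Set (ℝ × ℝ)),
      IsSymplecticDiffeo f ∧ IsSeparatrix f S ∧
      -- `W` is an open subset of `S ∪ Δ_S` that contains `S`
      (∃ O : Set (ℝ × ℝ), IsOpen O ∧ W = (S ∪ boundedDomain S) ∩ O) ∧ S ⊆ W ∧
      -- there is no `f`-invariant circle in `W \ S`
      (∀ C : Set (ℝ × ℝ), IsCircle C → C ⊆ W \ S → f '' C ≠ C) ∧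
      -- `f` is a local perturbation of the time-`1` map of a Hamiltonian equal to `x y` near `0`
      IsLocalPerturbation f S ∧
      -- an orbit of `f` in `Δ_S` accumulates on `S`
      (∃ z ∈ boundedDomain S, ∃ p : ℕ → ℕ, Tendsto p atTop atTop ∧
        Tendsto (fun n => Metric.infDist ((f ^ p n) z) S) atTop (𝓝 0)) := by
  obtain ⟨Φ, h⟩ := exists_isHamFlow contDiff_loopHam exists_lipschitzWith_hamVectorField_loopHam
  obtain ⟨Ψ, k⟩ := exists_isHamFlow contDiff_kickHam exists_lipschitzWith_hamVectorField_kickHam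
  obtain ⟨z, hz, p, hp, hzp⟩ := exists_drifting_orbit h k
  have hsymp := isSymplecticDiffeo_perturbedMap h k
  have hsep := isSeparatrix_perturbedMap h k
  have hlin := eventually_perturbedMap_eq h k
  have hloc := isLocalPerturbation_perturbedMap h k
  set f := perturbedMap h k
  have hfc : Continuous f := hsymp.contDiff.continuous
  let φ : (ℝ × ℝ) ≃ₜ (ℝ × ℝ) := ⟨f, hfc, hsymp.contDiff_symm.continuous⟩
  have hnear : ∀ᶠ q in 𝓝 (0 : ℝ × ℝ),
      f q = (Real.exp (-1) * q.1, Real.exp 1 * q.2) ∧ q.1 < 2 ∧ q.2 < 2 :=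
    hlin.and ((continuous_fst.continuousAt.eventually_lt_const (by simp)).and
      (continuous_snd.continuousAt.eventually_lt_const (by simp)))
  obtain ⟨B, hB, hBo, hB0⟩ := eventually_nhds_iff.1 hnear
  -- Points that `f` moves off their ray from the centre; avoiding division makes the condition
  -- visibly open.
  let R : Set (ℝ × ℝ) :=
    {q | ‖q - loopCenter‖ • (f q - loopCenter) ≠ ‖f q - loopCenter‖ • (q - loopCenter)}
  have hR : IsOpen R := isOpen_ne_fun (by fun_prop) (by fun_prop)
  have hloopR : ∀ q ∈ loop, q ≠ 0 → q ∈ R := by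
    intro q hq hq0 heq
    have hfq : f q ∈ loop := by
      rw [← hsep.invariant]; exact mem_image_of_mem f hq
    have hne : 0 < ‖q - loopCenter‖ := norm_pos_iff.2 (sub_ne_zero.2 (loopCenter_ne_of_mem_loop hq))
    refine hq0 (eq_zero_of_fixed_of_isSeparatrix hsep hq (eq_of_ray_of_mem_loop hq hfq
      (r := ‖q - loopCenter‖⁻¹ * ‖f q - loopCenter‖) (by positivity) ?_))
    rw [mul_smul, ← heq, smul_smul, inv_mul_cancel₀ hne.ne', one_smul]
  -- The energy bound keeps circles below the level of z; R and B exclude points kept on their ray,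
  -- away from the saddle and near it.
  refine ⟨f, loop, (loop ∪ boundedDomain loop) ∩ ({q | loopHam q < loopHam z} ∩ (R ∪ B)),
    hsymp, hsep, ⟨_, (isOpen_lt continuous_loopHam continuous_const).inter (hR.union hBo), rfl⟩,
    fun q hq => ⟨Or.inl hq, ?_, ?_⟩, fun C hC hCW hfC => ?_, hloc,
    ⟨z, by rwa [boundedDomain_loop], p, hp, hzp⟩⟩
  · rw [mem_ofPred_eq, hq.1]; exact hz.1
  · by_cases hq0 : q = 0
    · exact Or.inr (hq0 ▸ hB0)
    · exact Or.inl (hloopR q hq hq0)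
  · have hint : ∀ w ∈ C, w ∈ loopInterior := fun w hw => by
      have hw' := hCW hw
      rw [boundedDomain_loop] at hw'
      exact hw'.1.1.resolve_left hw'.2
    -- The component of 0 contains the loop and is invariant under f, so an orbit that comes close
    -- to the loop started in it.
    have hz0 : z ∈ connectedComponentIn Cᶜ 0 :=
      mem_connectedComponentIn_of_tendsto_infDist φ hC.isCompact.isClosed hfC isCompact_loop
        isConnected_loop.isPreconnected (fun q hq hqC => (hCW hqC).2 hq) zero_mem_loop
        hsep.hyperbolic.fixed (p := p) (by
          refine hzp.congr fun n => ?_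
          rw [Equiv.Perm.coe_pow]; rfl)
    have hcen : loopCenter ∈ connectedComponentIn Cᶜ 0 := by
      rw [connectedComponentIn_eq hz0]
      exact loopCenter_mem_connectedComponentIn hz fun w hw => (hCW hw).1.2.1
    obtain ⟨w, hw, r, hr, hwr⟩ := exists_same_ray hC.isCompact hC.isConnected hfc.continuousOn
      (fun w hw => by rw [← hfC]; exact mem_image_of_mem f hw) (fun w hw => (hint w hw).2) hcen
    rcases (hCW hw).1.2.2 with hwR | hwB
    · refine hwR ?_
      rw [hwr, norm_smul, Real.norm_of_nonneg hr.le, smul_smul, mul_comm]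
    · obtain ⟨hfw, h1, h2⟩ := hB w hwB
      have hI := hint w hw
      have hxy := hI.1
      rw [loopHam_of_le (by linarith)] at hxy
      have hs := hI.2
      rw [hfw] at hwr
      rcases pos_and_pos_or_neg_and_neg_of_mul_pos hxy with h3 | h3
      · exact not_ray_linear h3.1 h3.2 h1 h2 hwr
      · linarith [h3.1, h3.2]
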